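/- Let $N\ge 1$ and let $d_0,\dots,d_N$ be layer widths, $m=d_0$, $n=d_N\ge 1$. For a tuple $\overrightarrow W=(W_1,\dots,W_N)$ with $W_j\in\mathbb R^{d_j\times d_{j-1}}$ write $W=W_N\cdots W_1\in\mathbb R^{n\times m}$ and $\Sigma=WW^\top$. Let $\Sigma_0\in\mathbb R^{n\times n}$ be symmetric positive semidefinite, and consider the Bures-Wasserstein loss $$L(\Sigma)=\operatorname{tr}\Big(\Sigma+\Sigma_0-2\big(\Sigma_0^{1/2}\Sigma\,\Sigma_0^{1/2}\big)^{1/2}\Big),\qquad L^N(\overrightarrow W)=L(WW^\top).$$ Let $c>0$ and let $t\mapsto\overrightarrow W(t)$ be a solution on $[0,T]$ (with $T$ arbitrary; thus solutions on $[0,\infty)$ are covered) of the gradient flow $\dot{\overrightarrow W}(t)=-\nabla L^N(\overrightarrow W(t))$ with respect to the Frobenius inner product. Write $\Sigma(t)=W(t)W(t)^\top$. Assume that the initial weights are balanced, $W_j(0)W_j(0)^\top=W_{j+1}(0)^\top W_{j+1}(0)$ for $1\le j\le N-1$, and that $\Sigma(0)$ has modified deficiency margin $c$ with respect to $\Sigma_0$,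 i.e. $$\min_{U\in\mathcal O(n)}\big\|\Sigma(0)^{1/2}-\Sigma_0^{1/2}U\big\|_F\le\sigma_{\min}(\Sigma_0^{1/2})-c .$$ Let $\Sigma^*$ be a minimizer of $L$ over the symmetric positive definite $n\times n$ matrices, and put $$K=\frac{\sqrt{c^2\lambda_{\min}(\Sigma_0)}}{2C^2},\qquad C=2\big(L(\Sigma(0))+\operatorname{tr}\Sigma_0\big).$$ Then, for every $t\in[0,T]$, the loss $L^N$ is differentiable at $\overrightarrow W(t)$, $\lambda_{\min}(\Sigma(t))\ge c^2$, and $$L(\Sigma(t))-L(\Sigma^*)\le e^{-8N c^{\frac{2(2N-1)}{N}}Kt}\,\Delta_0^*,$$ both with $\Delta_0^*=L(\Sigma(0))-L(\Sigma^*)$ and with $\Delta_0^*=\|\Sigma(0)-\Sigma^*\|_F$. -/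

import Mathlib

open Matrix

noncomputable section

namespace BWFlow

section Matrices

open scoped MatrixOrder

/-- The positive semidefinite square root `A^{1/2}` of a positive semidefinite matrix. -/
def msqrt {n : ℕ} (A : Matrix (Fin n) (Fin n) ℝ) : Matrix (Fin n) (Fin n) ℝ :=
  CFC.sqrt A

end Matrices

/-- The Frobenius norm `‖A‖_F = √⟨A, A⟩`, where `⟨A, B⟩ = tr (Aᵀ B)`. -/
def frobNorm {m n : ℕ} (A : Matrix (Fin m) (Fin n) ℝ) : ℝ :=
  Real.sqrt (Aᵀ * A).trace

/-- The smallest eigenvalue of a symmetric real matrix (of positive size). -/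
def lambdaMin {n : ℕ} (A : Matrix (Fin n) (Fin n) ℝ) : ℝ :=
  sInf (spectrum ℝ A)

/-- The smallest singular value of a square real matrix (of positive size). -/
def sigmaMin {n : ℕ} (A : Matrix (Fin n) (Fin n) ℝ) : ℝ :=
  Real.sqrt (lambdaMin (Aᵀ * A))

/-- The loss in covariance space: the squared Bures-Wasserstein distance of `S` to the target,
`L(Σ) = tr (Σ + Σ₀ - 2 (Σ₀^{1/2} Σ Σ₀^{1/2})^{1/2})`. -/
def bwLoss {n : ℕ} (S₀ S : Matrix (Fin n) (Fin n) ℝ) : ℝ :=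
  (S + S₀ - (2 : ℝ) • msqrt (msqrt S₀ * S * msqrt S₀)).trace

/-- `S` has modified deficiency margin `c` with respect to `S₀`:
`min_{U ∈ O(n)} ‖Σ^{1/2} - Σ₀^{1/2} U‖_F ≤ σ_min (Σ₀^{1/2}) - c`. -/
def HasModifiedDeficiencyMargin {n : ℕ} (S₀ S : Matrix (Fin n) (Fin n) ℝ) (c : ℝ) : Prop :=
  (⨅ U : Matrix.orthogonalGroup (Fin n) ℝ,
    frobNorm (msqrt S - msqrt S₀ * (U : Matrix (Fin n) (Fin n) ℝ))) ≤ sigmaMin (msqrt S₀) - c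

/-- The parameter space of a linear network with `N` layers and widths `d 0, …, d N`
(only these values of `d` matter). The Hilbert space structure is
`⟨V, W⟩ = ∑ j, tr (V_jᵀ W_j)`. -/
abbrev Params (N : ℕ) (d : ℕ → ℕ) : Type :=
  PiLp 2 (fun j : Fin N => EuclideanSpace ℝ (Fin (d (j.1 + 1)) × Fin (d j.1)))

variable {N : ℕ} {d : ℕ → ℕ}

/-- The weight matrix `W_{j+1}`, of size `d (j+1) × d j`, for `j = 0, …, N-1`. -/
def layer (W : Params N d) (j : ℕ) (hj : j < N) : Matrix (Fin (d (j + 1))) (Fin (d j)) ℝ :=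
  Matrix.of fun a b => W ⟨j, hj⟩ (a, b)

/-- The partial product `W_k ⋯ W_1`, for `k ≤ N` (the identity if `k = 0`). -/
def partialProd (W : Params N d) : (k : ℕ) → k ≤ N → Matrix (Fin (d k)) (Fin (d 0)) ℝ
  | 0, _ => 1
  | k + 1, h => layer W k h * partialProd W k (Nat.le_of_succ_le h)

/-- The end-to-end matrix `W = W_N ⋯ W_1`. -/
def endToEnd (W : Params N d) : Matrix (Fin (d N)) (Fin (d 0)) ℝ :=
  partialProd W N le_rfl

/-- The covariance matrix `Σ = W Wᵀ` of the end-to-end matrix `W`. -/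
def covariance (W : Params N d) : Matrix (Fin (d N)) (Fin (d N)) ℝ :=
  endToEnd W * (endToEnd W)ᵀ

/-- The loss `L^N` in parameter space. -/
def paramLoss (S₀ : Matrix (Fin (d N)) (Fin (d N)) ℝ) (W : Params N d) : ℝ :=
  bwLoss S₀ (covariance W)

/-- Balanced weights: `W_j W_jᵀ = W_{j+1}ᵀ W_{j+1}` for all `1 ≤ j ≤ N - 1`. -/
def Balanced (W : Params N d) : Prop :=
  ∀ (j : ℕ) (h : j + 1 < N),
    layer W j (Nat.lt_of_succ_lt h) * (layer W j (Nat.lt_of_succ_lt h))ᵀ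
      = (layer W (j + 1) h)ᵀ * layer W (j + 1) h

/-- `W` solves the gradient flow equation `W'(t) = -∇ L^N (W(t))` on `[0, T]`
(with one-sided derivatives at the end points). -/
def IsGradientFlow (S₀ : Matrix (Fin (d N)) (Fin (d N)) ℝ) (T : ℝ) (W : ℝ → Params N d) : Prop :=
  ∀ t ∈ Set.Icc (0 : ℝ) T,
    HasDerivWithinAt W (-(gradient (paramLoss S₀) (W t))) (Set.Icc 0 T) t

/-- The constant `C = 2 (L(Σ(0)) + tr Σ₀)`, where `S` stands for `Σ(0)`. -/
def constC {n : ℕ} (S₀ S : Matrix (Fin n) (Fin n) ℝ) : ℝ :=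
  2 * (bwLoss S₀ S + S₀.trace)

/-- The constant `K = √(c² λ_min(Σ₀)) / (2 C²)`, where `S` stands for `Σ(0)`. -/
def constK {n : ℕ} (S₀ S : Matrix (Fin n) (Fin n) ℝ) (c : ℝ) : ℝ :=
  Real.sqrt (c ^ 2 * lambdaMin S₀) / (2 * constC S₀ S ^ 2)

end BWFlow

end

open Matrix

noncomputable section

namespace BWFlow

/-! ### Trace and Loewner-order inequalities for real matrices. -/

section MatrixFacts

variable {ι κ : Type*}

/-! For positive definite `S` let `Γ` be the transport map with `Γ S Γ = S₀`, and put `G = 1 - Γ`.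
Then `L(S) = tr (G S G)`, and `G` is also the gradient of `L` at `S`. With respect to the end-to-end
matrix the gradient is `2 G W`, whose squared norm is `4 tr (G Σ G) = 4 L`: an exact
Polyak-Łojasiewicz identity.

Passing to the layers multiplies this by at least `N p ^ (N - 1)` when `Σ ≥ p ^ N`, provided the
weights are balanced, since all Gram matrices then become powers of one matrix
(`le_inner_paramGrad`). Balancedness is conserved by the flow (`balanced_of_flow`). With `p ^ N = c
^ 2` the loss decays at a rate that dominates the stated one (`rate_le`).

The bound `Σ ≥ c ^ 2` persists because it follows from the loss alone: `L = ‖X - X Γ‖²` in Frobenius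
norm with `X = Σ^{1/2}`, while `X Γ` has Gram matrix `S₀`, so `L ≤ (σ - c) ^ 2` leaves `X` with
least singular value at least `c`, where `σ` is that of `S₀^{1/2}`
(`posSemidef_sub_sq_of_bwLoss_le`). The loss does not increase while `Σ` is invertible, and
continuous induction closes the circle. -/

theorem transpose_eq_of_posSemidef {A : Matrix ι ι ℝ} (hA : A.PosSemidef) : Aᵀ = A := by
  have h := hA.isHermitian
  rwa [IsHermitian, conjTranspose_eq_transpose_of_trivial] at h

variable [Fintype ι] [Fintype κ]

theorem posSemidef_transpose_mul_mul {A : Matrix ι ι ℝ} (hA : A.PosSemidef) (B : Matrix ι κ ℝ) :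
    (Bᵀ * A * B).PosSemidef := by
  simpa [conjTranspose_eq_transpose_of_trivial] using hA.conjTranspose_mul_mul_same B

theorem posSemidef_mul_transpose_self (B : Matrix ι κ ℝ) : (B * Bᵀ).PosSemidef := by
  simpa [conjTranspose_eq_transpose_of_trivial] using posSemidef_self_mul_conjTranspose B

theorem trace_transpose_mul_self (A : Matrix κ ι ℝ) : (Aᵀ * A).trace = ∑ i, ∑ j, A i j ^ 2 := by
  rw [Finset.sum_comm]
  simp [Matrix.trace, Matrix.mul_apply, sq]

theorem mulVec_dotProduct_self_le (A : Matrix κ ι ℝ) (x : ι → ℝ) :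
    (A *ᵥ x) ⬝ᵥ (A *ᵥ x) ≤ (Aᵀ * A).trace * (x ⬝ᵥ x) := by
  rw [trace_transpose_mul_self, Finset.sum_mul]
  refine Finset.sum_le_sum fun i _ => ?_
  have := Finset.sum_mul_sq_le_sq_mul_sq Finset.univ (A i) x
  simpa [mulVec, dotProduct, sq] using this

/-- The reverse triangle inequality for the Euclidean norm, in squared form. -/
theorem sq_mul_le_dotProduct_self {u v : ι → ℝ} {a b q : ℝ} (hb : 0 ≤ b) (hba : b ≤ a)
    (hq : 0 ≤ q) (hv : a ^ 2 * q ≤ v ⬝ᵥ v) (huv : (v - u) ⬝ᵥ (v - u) ≤ (a - b) ^ 2 * q) :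
    b ^ 2 * q ≤ u ⬝ᵥ u := by
  have key : ∀ w : ι → ℝ, w ⬝ᵥ w = ‖WithLp.toLp 2 w‖ ^ 2 := by
    intro w
    rw [EuclideanSpace.norm_sq_eq]
    simp [dotProduct, sq]
  have hr := Real.sq_sqrt hq
  have hr0 := Real.sqrt_nonneg q
  rw [key, ← hr, ← mul_pow] at hv huv ⊢
  have h1 := abs_le_of_sq_le_sq' hv (norm_nonneg _) |>.2
  have h2 := abs_le_of_sq_le_sq' huv (mul_nonneg (sub_nonneg.2 hba) hr0) |>.2
  have h3 : ‖WithLp.toLp 2 v‖ - ‖WithLp.toLp 2 u‖ ≤ ‖WithLp.toLp 2 (v - u)‖ := norm_sub_norm_le _ _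
  exact pow_le_pow_left₀ (by positivity) (by linarith) 2

variable [DecidableEq ι] {n : ℕ}

section Order

open scoped MatrixOrder

theorem trace_mul_nonneg {A B : Matrix ι ι ℝ} (hA : A.PosSemidef) (hB : B.PosSemidef) :
    0 ≤ (A * B).trace := by
  set S := CFC.sqrt B
  have h1 : S * S = B := CFC.sqrt_mul_sqrt_self B hB.nonneg
  have h2 : Sᵀ = S := transpose_eq_of_posSemidef (CFC.sqrt_nonneg B).posSemidef
  have h3 : (A * B).trace = (Sᵀ * A * S).trace := by
    rw [h2, ← h1, ← Matrix.mul_assoc, Matrix.trace_mul_comm, Matrix.mul_assoc]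
  rw [h3]
  exact (posSemidef_transpose_mul_mul hA S).trace_nonneg

/-- The square root of `B` commutes with everything that `B` commutes with, so the product is a
congruence of `A`. -/
theorem posSemidef_mul_of_commute {A B : Matrix ι ι ℝ} (hA : A.PosSemidef) (hB : B.PosSemidef)
    (h : Commute A B) : (A * B).PosSemidef := by
  set S := CFC.sqrt B
  have h1 : S * S = B := CFC.sqrt_mul_sqrt_self B hB.nonneg
  have h2 : Sᵀ = S := transpose_eq_of_posSemidef (CFC.sqrt_nonneg B).posSemidef
  have h3 : Commute A S := (h.symm.cfcₙ_nnreal _).symm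
  have h4 : A * B = Sᵀ * A * S := by
    rw [h2, ← h1, ← Matrix.mul_assoc, h3.eq]
  rw [h4]
  exact posSemidef_transpose_mul_mul hA S

theorem msqrt_posSemidef (A : Matrix (Fin n) (Fin n) ℝ) : (msqrt A).PosSemidef :=
  (CFC.sqrt_nonneg A).posSemidef

theorem msqrt_mul_self {A : Matrix (Fin n) (Fin n) ℝ} (hA : A.PosSemidef) :
    msqrt A * msqrt A = A :=
  CFC.sqrt_mul_sqrt_self A hA.nonneg

theorem msqrt_self_mul {A : Matrix (Fin n) (Fin n) ℝ} (hA : A.PosSemidef) :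
    msqrt (A * A) = A :=
  CFC.sqrt_mul_self A hA.nonneg

theorem posSemidef_sub_smul_one_iff {A : Matrix ι ι ℝ} (hA : A.IsHermitian) (a : ℝ) :
    (A - a • 1).PosSemidef ↔ ∀ x ∈ spectrum ℝ A, a ≤ x := by
  rw [← algebraMap_le_iff_le_spectrum (ha := hA), Matrix.le_iff, Algebra.algebraMap_eq_smul_one]

end Order

theorem msqrt_transpose (A : Matrix (Fin n) (Fin n) ℝ) : (msqrt A)ᵀ = msqrt A :=
  transpose_eq_of_posSemidef (msqrt_posSemidef A)

theorem posSemidef_sub_smul_one_iff_le_lambdaMin {A : Matrix (Fin n) (Fin n) ℝ} (hn : 0 < n)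
    (hA : A.IsHermitian) (a : ℝ) : (A - a • 1).PosSemidef ↔ a ≤ lambdaMin A := by
  have : Nonempty (Fin n) := ⟨⟨0, hn⟩⟩
  have hs := hA.spectrum_real_eq_range_eigenvalues
  have hne : (spectrum ℝ A).Nonempty := hs ▸ Set.range_nonempty _
  have hfin : (spectrum ℝ A).Finite := hs ▸ Set.finite_range _
  rw [posSemidef_sub_smul_one_iff hA, lambdaMin, le_csInf_iff hfin.bddBelow hne]

theorem posSemidef_sub_smul_one_iff_dotProduct {A : Matrix ι ι ℝ} (hA : A.IsHermitian) (a : ℝ) :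
    (A - a • 1).PosSemidef ↔ ∀ x : ι → ℝ, a * (x ⬝ᵥ x) ≤ x ⬝ᵥ A *ᵥ x := by
  have hH : (A - a • (1 : Matrix ι ι ℝ)).IsHermitian := by
    refine hA.sub ?_
    rw [IsHermitian, conjTranspose_smul, conjTranspose_one, star_trivial]
  rw [posSemidef_iff_dotProduct_mulVec]
  simp only [hH, true_and, star_trivial, sub_mulVec, smul_mulVec, one_mulVec, dotProduct_sub,
    dotProduct_smul, smul_eq_mul, sub_nonneg]

theorem posDef_of_posSemidef_sub_smul_one {μ : Type*} [Finite μ] [DecidableEq μ]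
    {A : Matrix μ μ ℝ} {a : ℝ} (ha : 0 < a)
    (h : (A - a • 1).PosSemidef) : A.PosDef := by
  have := (PosDef.one (n := μ) (R := ℝ)).smul ha |>.add_posSemidef h
  simpa using this

theorem posSemidef_pow_sub {A : Matrix ι ι ℝ} {a : ℝ} (ha : 0 ≤ a) (hA : A.PosSemidef)
    (h : (A - a • 1).PosSemidef) (k : ℕ) : (A ^ k - a ^ k • 1).PosSemidef := by
  rw [posSemidef_sub_smul_one_iff (hA.pow k).isHermitian]
  rw [posSemidef_sub_smul_one_iff hA.isHermitian] at h
  intro x hx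
  rw [← cfc_pow_id (R := ℝ) A k (ha := hA.isHermitian), cfc_map_spectrum (R := ℝ) (fun x => x ^ k) A
    (ha := hA.isHermitian)] at hx
  obtain ⟨y, hy, rfl⟩ := hx
  exact pow_le_pow_left₀ ha (h y hy) k

theorem posSemidef_sub_of_pow {A : Matrix ι ι ℝ} {a : ℝ} (hA : A.PosSemidef) {k : ℕ} (hk : k ≠ 0)
    (h : (A ^ k - a ^ k • 1).PosSemidef) : (A - a • 1).PosSemidef := by
  rw [posSemidef_sub_smul_one_iff hA.isHermitian]
  rw [posSemidef_sub_smul_one_iff (hA.pow k).isHermitian] at h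
  intro x hx
  have hx0 : 0 ≤ x := (posSemidef_iff_isHermitian_and_spectrum_nonneg.1 hA).2 hx
  refine le_of_pow_le_pow_left₀ hk hx0 (h _ ?_)
  rw [← cfc_pow_id (R := ℝ) A k (ha := hA.isHermitian), cfc_map_spectrum (R := ℝ) (fun x => x ^ k) A
    (ha := hA.isHermitian)]
  exact ⟨x, hx, rfl⟩

/-- Each power of `P` dominates the same power of the scalar `p`. One use strips `k` factors from
the right-hand power, another the `a` factors between the two copies of `G`. In the network the
exponents `a` and `k` count the layers after and before a given one. -/
theorem trace_mul_pow_mul_ge {P G : Matrix ι ι ℝ} (hP : P.PosSemidef) (hG : Gᵀ = G) {p : ℝ}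
    (hp : 0 ≤ p) (h : (P - p • 1).PosSemidef) (a k m : ℕ) :
    p ^ (a + k) * (G * P ^ m * G).trace ≤ (G * P ^ a * G * P ^ (m + k)).trace := by
  have h1 : (P ^ (m + k) - p ^ k • P ^ m).PosSemidef := by
    have : P ^ (m + k) - p ^ k • P ^ m = P ^ m * (P ^ k - p ^ k • 1) := by
      rw [Matrix.mul_sub, pow_add, Matrix.mul_smul, Matrix.mul_one]
    rw [this]
    refine posSemidef_mul_of_commute (hP.pow m) (posSemidef_pow_sub hp hP h k) ?_
    refine Commute.sub_right ((Commute.refl P).pow_pow m k) ?_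
    exact (Commute.one_right _).smul_right _
  have h2 : (G * (P ^ a) * G).PosSemidef := by
    have := posSemidef_transpose_mul_mul (hP.pow a) G
    rwa [hG] at this
  have h3 := trace_mul_nonneg h2 h1
  rw [Matrix.mul_sub, trace_sub, Matrix.mul_smul, trace_smul, sub_nonneg, smul_eq_mul] at h3
  refine le_trans ?_ h3
  have h4 : (G * (P ^ m) * G).PosSemidef := by
    have := posSemidef_transpose_mul_mul (hP.pow m) G
    rwa [hG] at this
  have h5 := trace_mul_nonneg (posSemidef_pow_sub hp hP h a) h4
  rw [Matrix.sub_mul, trace_sub, Matrix.smul_mul, trace_smul, sub_nonneg, smul_eq_mul,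
    Matrix.one_mul] at h5
  have h6 : (P ^ a * (G * P ^ m * G)).trace = (G * P ^ a * G * P ^ m).trace := by
    rw [← Matrix.mul_assoc, trace_mul_comm]
    simp only [Matrix.mul_assoc]
  rw [h6] at h5
  calc _ = p ^ k * (p ^ a * (G * P ^ m * G).trace) := by ring
    _ ≤ _ := mul_le_mul_of_nonneg_left h5 (by positivity)

/-- A Lipschitz estimate for the matrix square root. -/
theorem sq_mul_trace_sub_le {X Y : Matrix ι ι ℝ} {s : ℝ} (hs : 0 ≤ s)
    (hX : X.PosSemidef) (hY : Y.PosSemidef) (h : (X - s • 1).PosSemidef) :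
    s ^ 2 * ((X - Y)ᵀ * (X - Y)).trace ≤ ((X * X - Y * Y)ᵀ * (X * X - Y * Y)).trace := by
  have hXt := transpose_eq_of_posSemidef hX
  have hYt := transpose_eq_of_posSemidef hY
  set D := X - Y with hD
  set E := X * X - Y * Y with hE
  have hDt : Dᵀ = D := by rw [hD, transpose_sub, hXt, hYt]
  have hEt : Eᵀ = E := by rw [hE, transpose_sub, transpose_mul, transpose_mul, hXt, hYt]
  -- A Sylvester equation for `D`: pairing it with `D` loses nothing from `Y` and gains at least `s`
  -- from `X`.
  have hED : E = X * D + D * Y := by rw [hE, hD]; noncomm_ring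
  have h1 : s * (D * D).trace ≤ (D * E).trace := by
    have a1 := trace_mul_nonneg h (posSemidef_mul_transpose_self D)
    have a2 := (posSemidef_transpose_mul_mul hY D).trace_nonneg
    have a3 : (D * (D * Y)).trace = (D * Y * D).trace := by rw [trace_mul_comm]
    have a4 : (D * (X * D)).trace = (X * (D * D)).trace := by
      rw [trace_mul_comm, Matrix.mul_assoc]
    rw [hDt] at a1 a2
    rw [Matrix.sub_mul, trace_sub, Matrix.smul_mul, trace_smul, Matrix.one_mul, smul_eq_mul] at a1
    rw [hED, Matrix.mul_add, trace_add, a3, a4]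
    linarith
  -- Expanding this square replaces Cauchy-Schwarz for the trace pairing.
  have h2 := (posSemidef_mul_transpose_self (E - s • D)).trace_nonneg
  rw [transpose_sub, transpose_smul, hDt, hEt] at h2
  have h3 : ((E - s • D) * (E - s • D)).trace
      = (E * E).trace - 2 * s * (D * E).trace + s ^ 2 * (D * D).trace := by
    simp only [Matrix.sub_mul, Matrix.mul_sub, trace_sub, Matrix.smul_mul, Matrix.mul_smul,
      trace_smul, smul_eq_mul, trace_mul_comm E D]
    ring
  rw [hDt, hEt]
  rw [h3] at h2
  nlinarith

theorem frobNorm_sq {m n : ℕ} (A : Matrix (Fin m) (Fin n) ℝ) :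
    frobNorm A ^ 2 = (Aᵀ * A).trace := by
  refine Real.sq_sqrt ?_
  have := (posSemidef_mul_transpose_self Aᵀ).trace_nonneg
  rwa [transpose_transpose] at this

end MatrixFacts

/-! ### The Bures-Wasserstein loss and its first-order expansion. -/

section Loss

variable {n : ℕ} {S₀ S : Matrix (Fin n) (Fin n) ℝ}

theorem posDef_msqrt (hS : S.PosDef) : (msqrt S).PosDef := by
  rw [(msqrt_posSemidef S).posDef_iff_det_ne_zero]
  intro h
  have h1 := congrArg det (msqrt_mul_self hS.posSemidef)
  rw [det_mul, h, zero_mul] at h1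
  exact hS.det_pos.ne h1

theorem posDef_conj_msqrt (hS₀ : S₀.PosDef) (hS : S.PosDef) :
    (msqrt S₀ * S * msqrt S₀).PosDef := by
  have h := hS.conjTranspose_mul_mul_same (B := msqrt S₀)
    (mulVec_injective_iff_isUnit.2 (posDef_msqrt hS₀).isUnit)
  rwa [conjTranspose_eq_transpose_of_trivial, msqrt_transpose] at h

theorem posSemidef_conj_msqrt (hS : S.PosSemidef) :
    (msqrt S₀ * S * msqrt S₀).PosSemidef := by
  have h := posSemidef_transpose_mul_mul hS (msqrt S₀)
  rwa [msqrt_transpose] at h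

theorem lambdaMin_pos (hn : 0 < n) (hS : S.PosDef) : 0 < lambdaMin S := by
  have : Nonempty (Fin n) := ⟨⟨0, hn⟩⟩
  have hs := hS.isHermitian.spectrum_real_eq_range_eigenvalues
  have hne : (spectrum ℝ S).Nonempty := hs ▸ Set.range_nonempty _
  have hfin : (spectrum ℝ S).Finite := hs ▸ Set.finite_range _
  have hmem := hne.csInf_mem hfin
  rw [← lambdaMin, hs] at hmem
  obtain ⟨i, hi⟩ := hmem
  exact hi ▸ hS.eigenvalues_pos i

/-- The optimal transport map `S₀^{1/2} (S₀^{1/2} S S₀^{1/2})^{-1/2} S₀^{1/2}` from the centred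
Gaussian measure of covariance `S` to that of covariance `S₀`. -/
def transportMap (S₀ S : Matrix (Fin n) (Fin n) ℝ) : Matrix (Fin n) (Fin n) ℝ :=
  msqrt S₀ * (msqrt (msqrt S₀ * S * msqrt S₀))⁻¹ * msqrt S₀

theorem transportMap_transpose : (transportMap S₀ S)ᵀ = transportMap S₀ S := by
  rw [transportMap, transpose_mul, transpose_mul, transpose_nonsing_inv, msqrt_transpose,
    msqrt_transpose, ← Matrix.mul_assoc]

theorem isUnit_det_msqrt_conj (hS₀ : S₀.PosDef) (hS : S.PosDef) :
    IsUnit (msqrt (msqrt S₀ * S * msqrt S₀)).det :=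
  (isUnit_iff_isUnit_det _).1 (posDef_msqrt (posDef_conj_msqrt hS₀ hS)).isUnit

theorem transportMap_mul_mul (hS₀ : S₀.PosDef) (hS : S.PosDef) :
    transportMap S₀ S * S * transportMap S₀ S = S₀ := by
  have hM := msqrt_mul_self (posDef_conj_msqrt hS₀ hS).posSemidef
  have hu := isUnit_det_msqrt_conj hS₀ hS
  have h0 := msqrt_mul_self hS₀.posSemidef
  rw [transportMap]
  set M := msqrt (msqrt S₀ * S * msqrt S₀)
  set R := msqrt S₀
  calc R * M⁻¹ * R * S * (R * M⁻¹ * R) = R * (M⁻¹ * (R * S * R) * M⁻¹) * R := by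
        simp only [Matrix.mul_assoc]
    _ = R * R := by
        rw [← hM, ← Matrix.mul_assoc M⁻¹, nonsing_inv_mul _ hu, Matrix.one_mul,
          mul_nonsing_inv _ hu, Matrix.mul_one]
    _ = S₀ := h0

theorem trace_transportMap_mul (S' : Matrix (Fin n) (Fin n) ℝ) :
    (transportMap S₀ S * S').trace
      = ((msqrt (msqrt S₀ * S * msqrt S₀))⁻¹ * (msqrt S₀ * S' * msqrt S₀)).trace := by
  rw [transportMap, Matrix.mul_assoc, Matrix.mul_assoc, trace_mul_comm]
  simp only [Matrix.mul_assoc]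

theorem trace_transportMap_mul_self (hS₀ : S₀.PosDef) (hS : S.PosDef) :
    (transportMap S₀ S * S).trace = (msqrt (msqrt S₀ * S * msqrt S₀)).trace := by
  have hM := msqrt_mul_self (posDef_conj_msqrt hS₀ hS).posSemidef
  have hu := isUnit_det_msqrt_conj hS₀ hS
  rw [trace_transportMap_mul]
  set M := msqrt (msqrt S₀ * S * msqrt S₀)
  rw [← hM, ← Matrix.mul_assoc, nonsing_inv_mul _ hu, Matrix.one_mul]

theorem bwLoss_eq (S₀ S : Matrix (Fin n) (Fin n) ℝ) :
    bwLoss S₀ S = S.trace + S₀.trace - 2 * (msqrt (msqrt S₀ * S * msqrt S₀)).trace := by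
  rw [bwLoss, trace_sub, trace_add, trace_smul, smul_eq_mul]

/-- The loss is the transport cost of the map `Γ`: expanding, `Γ S Γ` is the target and each cross
term has the trace of `(S₀^{1/2} S S₀^{1/2})^{1/2}`. -/
theorem bwLoss_eq_trace (hS₀ : S₀.PosDef) (hS : S.PosDef) :
    bwLoss S₀ S = ((1 - transportMap S₀ S) * S * (1 - transportMap S₀ S)).trace := by
  have h1 := trace_transportMap_mul_self hS₀ hS
  have h2 := transportMap_mul_mul hS₀ hS
  have h3 : (1 - transportMap S₀ S) * S * (1 - transportMap S₀ S)
      = S - transportMap S₀ S * S - S * transportMap S₀ S + S₀ := by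
    generalize transportMap S₀ S = Γ at h2
    rw [← h2]
    noncomm_ring
  rw [h3, bwLoss_eq, trace_add, trace_sub, trace_sub, trace_mul_comm S, h1]
  ring

theorem posSemidef_residual (hS : S.PosSemidef) :
    ((1 - transportMap S₀ S) * S * (1 - transportMap S₀ S)).PosSemidef := by
  have h := posSemidef_transpose_mul_mul hS (1 - transportMap S₀ S)
  rwa [transpose_sub, transpose_one, transportMap_transpose] at h

theorem bwLoss_nonneg (hS₀ : S₀.PosDef) (hS : S.PosDef) : 0 ≤ bwLoss S₀ S := by
  rw [bwLoss_eq_trace hS₀ hS]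
  exact (posSemidef_residual hS.posSemidef).trace_nonneg

theorem bwLoss_target (hS₀ : S₀.PosDef) : bwLoss S₀ S₀ = 0 := by
  have h0 := msqrt_mul_self hS₀.posSemidef
  have h1 : msqrt S₀ * S₀ * msqrt S₀ = S₀ * S₀ := by
    generalize msqrt S₀ = R at h0
    rw [← h0]
    noncomm_ring
  rw [bwLoss_eq, h1, msqrt_self_mul hS₀.posSemidef]
  ring

/-- A positive semidefinite residual of trace zero vanishes; it is the Gram matrix of `S^{1/2} G`,
and `S^{1/2}` is invertible, so the transport map is the identity. -/
theorem eq_target_of_bwLoss_eq_zero (hS₀ : S₀.PosDef) (hS : S.PosDef) (h : bwLoss S₀ S = 0) :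
    S = S₀ := by
  rw [bwLoss_eq_trace hS₀ hS, (posSemidef_residual hS.posSemidef).trace_eq_zero_iff] at h
  set G := 1 - transportMap S₀ S with hG
  have hGt : Gᵀ = G := by rw [hG, transpose_sub, transpose_one, transportMap_transpose]
  have hX := msqrt_mul_self hS.posSemidef
  have h1 : msqrt S * G = 0 := by
    rw [← conjTranspose_mul_self_eq_zero, conjTranspose_eq_transpose_of_trivial, transpose_mul,
      msqrt_transpose, hGt, Matrix.mul_assoc, ← Matrix.mul_assoc (msqrt S), hX,
      ← Matrix.mul_assoc, h]
  have hu := (isUnit_iff_isUnit_det _).1 (posDef_msqrt hS).isUnit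
  have h2 : G = 0 := by
    rw [← Matrix.one_mul G, ← nonsing_inv_mul _ hu, Matrix.mul_assoc, h1, Matrix.mul_zero]
  have h3 := transportMap_mul_mul hS₀ hS
  rw [hG, sub_eq_zero] at h2
  rwa [← h2, Matrix.one_mul, Matrix.mul_one] at h3

/-- The minimizer of the loss over positive definite matrices is the target. -/
theorem eq_target_of_isMinOn (hS₀ : S₀.PosDef) (hS : S.PosDef)
    (hmin : IsMinOn (bwLoss S₀) {S | S.PosDef} S) : S = S₀ := by
  refine eq_target_of_bwLoss_eq_zero hS₀ hS (le_antisymm ?_ (bwLoss_nonneg hS₀ hS))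
  rw [← bwLoss_target hS₀]
  exact hmin hS₀

theorem exists_trace_mul_inv_mul_le (hn : 0 < n) {M : Matrix (Fin n) (Fin n) ℝ} (hM : M.PosDef) :
    ∃ s > 0, (M - s • 1).PosSemidef ∧ ∀ D : Matrix (Fin n) (Fin n) ℝ, Dᵀ = D →
      (D * M⁻¹ * D).trace ≤ s⁻¹ * (D * D).trace := by
  refine ⟨lambdaMin M, lambdaMin_pos hn hM, ?_, fun D hD => ?_⟩
  · exact (posSemidef_sub_smul_one_iff_le_lambdaMin hn hM.isHermitian _).2 le_rfl
  set s := lambdaMin M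
  have hs : 0 < s := lambdaMin_pos hn hM
  have hu := (isUnit_iff_isUnit_det _).1 hM.isUnit
  have h1 : (M - s • 1).PosSemidef :=
    (posSemidef_sub_smul_one_iff_le_lambdaMin hn hM.isHermitian _).2 le_rfl
  have h2 : (M⁻¹ * (M - s • 1)).PosSemidef := by
    refine posSemidef_mul_of_commute hM.inv.posSemidef h1 ?_
    refine Commute.sub_right ?_ ((Commute.one_right _).smul_right _)
    rw [Commute, SemiconjBy, nonsing_inv_mul _ hu, mul_nonsing_inv _ hu]
  rw [Matrix.mul_sub, nonsing_inv_mul _ hu, Matrix.mul_smul, Matrix.mul_one] at h2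
  have h3 := (posSemidef_transpose_mul_mul h2 D).trace_nonneg
  rw [hD, Matrix.mul_sub, Matrix.sub_mul, Matrix.mul_one, trace_sub, Matrix.mul_smul,
    Matrix.smul_mul, trace_smul, smul_eq_mul, sub_nonneg] at h3
  rwa [le_inv_mul_iff₀ hs]

/-- The loss agrees with its linearization up to a quadratic error. -/
theorem exists_abs_bwLoss_sub_le (hn : 0 < n) (hS₀ : S₀.PosDef) (hS : S.PosDef) :
    ∃ K : ℝ, ∀ S' : Matrix (Fin n) (Fin n) ℝ, S'.PosSemidef →
      |bwLoss S₀ S' - bwLoss S₀ S - ((1 - transportMap S₀ S) * (S' - S)).trace|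
        ≤ K * ∑ i, ∑ j, (msqrt S₀ * (S' - S) * msqrt S₀) i j ^ 2 := by
  have hMpd := posDef_msqrt (posDef_conj_msqrt hS₀ hS)
  obtain ⟨s, hs, hsM, hsD⟩ := exists_trace_mul_inv_mul_le hn hMpd
  -- The factor `s⁻¹` bounds `M⁻¹`; `(s ^ 2)⁻¹` comes from the Lipschitz estimate for the square
  -- root.
  refine ⟨s⁻¹ * (s ^ 2)⁻¹, fun S' hS' => ?_⟩
  have hM := msqrt_mul_self (posDef_conj_msqrt hS₀ hS).posSemidef
  have hu := isUnit_det_msqrt_conj hS₀ hS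
  have hM' := msqrt_mul_self (posSemidef_conj_msqrt (S₀ := S₀) hS')
  have hTS := trace_transportMap_mul_self hS₀ hS
  have hTS' := trace_transportMap_mul (S₀ := S₀) (S := S) S'
  rw [bwLoss_eq, bwLoss_eq]
  have hE : msqrt S₀ * (S' - S) * msqrt S₀
      = msqrt S₀ * S' * msqrt S₀ - msqrt S₀ * S * msqrt S₀ := by noncomm_ring
  rw [← trace_transpose_mul_self, hE]
  have hMp := msqrt_posSemidef (msqrt S₀ * S * msqrt S₀)
  have hMp' := msqrt_posSemidef (msqrt S₀ * S' * msqrt S₀)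
  set M := msqrt (msqrt S₀ * S * msqrt S₀)
  set M' := msqrt (msqrt S₀ * S' * msqrt S₀)
  rw [← hM'] at hTS'
  rw [← hM, ← hM']
  have hDt : (M - M')ᵀ = M - M' := by
    rw [transpose_sub, transpose_eq_of_posSemidef hMp, transpose_eq_of_posSemidef hMp']
  have hdef : ((M - M') * M⁻¹ * (M - M')).trace
      = M.trace - 2 * M'.trace + (M⁻¹ * (M' * M')).trace := by
    have : (M - M') * M⁻¹ * (M - M') = M - M' - M' + M' * M⁻¹ * M' := by
      rw [Matrix.sub_mul, mul_nonsing_inv _ hu, Matrix.sub_mul, Matrix.one_mul, Matrix.mul_sub,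
        Matrix.mul_assoc M' M⁻¹ M, nonsing_inv_mul _ hu, Matrix.mul_one]
      abel
    rw [this, trace_add, trace_sub, trace_sub, trace_mul_comm M⁻¹, Matrix.mul_assoc,
      Matrix.mul_assoc, trace_mul_comm M' (M⁻¹ * M'), trace_mul_comm M' (M' * M⁻¹),
      Matrix.mul_assoc, Matrix.mul_assoc, trace_mul_comm M' (M⁻¹ * M'), Matrix.mul_assoc]
    ring
  have hlin : ((1 - transportMap S₀ S) * (S' - S)).trace
      = S'.trace - S.trace - ((M⁻¹ * (M' * M')).trace - M.trace) := by
    rw [Matrix.sub_mul, Matrix.one_mul, trace_sub, trace_sub, Matrix.mul_sub, trace_sub, hTS, hTS']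
  -- The linearization error is exactly a square weighted by `M⁻¹`, hence nonnegative and quadratic
  -- in `M - M'`.
  have hval : S'.trace + S₀.trace - 2 * M'.trace - (S.trace + S₀.trace - 2 * M.trace)
      - ((1 - transportMap S₀ S) * (S' - S)).trace = ((M - M') * M⁻¹ * (M - M')).trace := by
    rw [hdef, hlin]; ring
  have hnn := (posSemidef_transpose_mul_mul hMpd.inv.posSemidef (M - M')).trace_nonneg
  rw [hDt] at hnn
  rw [hval, abs_of_nonneg hnn]
  have h1 := hsD _ hDt
  have h2 := sq_mul_trace_sub_le hs.le hMp hMp' hsM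
  rw [hDt] at h2
  have h3 : (M' * M' - M * M)ᵀ * (M' * M' - M * M) = (M * M - M' * M')ᵀ * (M * M - M' * M') := by
    rw [← neg_sub, transpose_neg, Matrix.neg_mul, Matrix.mul_neg, neg_neg]
  rw [h3, mul_assoc s⁻¹]
  refine h1.trans (mul_le_mul_of_nonneg_left ?_ (by positivity))
  rwa [le_inv_mul_iff₀ (by positivity)]

/-! ### The deficiency margin, the loss and the smallest eigenvalue. -/

theorem sigmaMin_msqrt_sq (hn : 0 < n) (hS₀ : S₀.PosSemidef) :
    sigmaMin (msqrt S₀) ^ 2 = lambdaMin S₀ := by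
  rw [sigmaMin, msqrt_transpose, msqrt_mul_self hS₀, Real.sq_sqrt]
  rw [← posSemidef_sub_smul_one_iff_le_lambdaMin hn hS₀.isHermitian]
  simpa using hS₀

theorem sigmaMin_nonneg (A : Matrix (Fin n) (Fin n) ℝ) : 0 ≤ sigmaMin A := Real.sqrt_nonneg _

theorem posSemidef_sub_sigmaMin_sq (hn : 0 < n) (hS₀ : S₀.PosSemidef) :
    (S₀ - sigmaMin (msqrt S₀) ^ 2 • 1).PosSemidef := by
  rw [posSemidef_sub_smul_one_iff_le_lambdaMin hn hS₀.isHermitian, sigmaMin_msqrt_sq hn hS₀]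

theorem posSemidef_msqrt_sub_sigmaMin (hn : 0 < n) (hS₀ : S₀.PosSemidef) :
    (msqrt S₀ - sigmaMin (msqrt S₀) • 1).PosSemidef := by
  refine posSemidef_sub_of_pow (msqrt_posSemidef S₀) two_ne_zero ?_
  rw [pow_two (msqrt S₀), msqrt_mul_self hS₀]
  exact posSemidef_sub_sigmaMin_sq hn hS₀

theorem dotProduct_mulVec_mul_self {ι κ : Type*} [Fintype ι] [Fintype κ] (A : Matrix κ ι ℝ)
    (x : ι → ℝ) : (A *ᵥ x) ⬝ᵥ (A *ᵥ x) = x ⬝ᵥ (Aᵀ * A) *ᵥ x := by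
  rw [← mulVec_mulVec, dotProduct_mulVec x, vecMul_transpose]

theorem le_sigmaMin_of_margin {c : ℝ} (hmargin : HasModifiedDeficiencyMargin S₀ S c) :
    c ≤ sigmaMin (msqrt S₀) := by
  have : 0 ≤ ⨅ U : Matrix.orthogonalGroup (Fin n) ℝ,
      frobNorm (msqrt S - msqrt S₀ * (U : Matrix (Fin n) (Fin n) ℝ)) :=
    Real.iInf_nonneg fun U => Real.sqrt_nonneg _
  linarith [this.trans hmargin]

/-- The slack `e` avoids showing that the infimum over the orthogonal group is attained. -/
theorem exists_orthogonal_of_margin {c e : ℝ} (he : 0 < e)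
    (hmargin : HasModifiedDeficiencyMargin S₀ S c) :
    ∃ U : Matrix.orthogonalGroup (Fin n) ℝ,
      frobNorm (msqrt S - msqrt S₀ * (U : Matrix (Fin n) (Fin n) ℝ))
        < sigmaMin (msqrt S₀) - c + e :=
  exists_lt_of_ciInf_lt (lt_of_le_of_lt hmargin (by linarith))

/-- Perturbation of singular values: `S₀^{1/2} U` stretches every vector by at least `σ_min`, and
the difference moves its image by at most `σ_min - b` times its length. -/
theorem posSemidef_sub_sq_of_frobNorm_le (hn : 0 < n) (hS₀ : S₀.PosSemidef) (hS : S.PosSemidef)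
    {b : ℝ} (hb : 0 ≤ b) (hbs : b ≤ sigmaMin (msqrt S₀)) (U : Matrix.orthogonalGroup (Fin n) ℝ)
    (hU : frobNorm (msqrt S - msqrt S₀ * (U : Matrix (Fin n) (Fin n) ℝ))
      ≤ sigmaMin (msqrt S₀) - b) : (S - b ^ 2 • 1).PosSemidef := by
  rw [posSemidef_sub_smul_one_iff_dotProduct hS.isHermitian]
  intro x
  have hUU : (U : Matrix (Fin n) (Fin n) ℝ)ᵀ * U = 1 := (mem_orthogonalGroup_iff' _ _).1 U.2
  have hq : 0 ≤ x ⬝ᵥ x := by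
    have := dotProduct_star_self_nonneg x
    rwa [star_trivial] at this
  have h1 := sq_mul_le_dotProduct_self (u := msqrt S *ᵥ x)
    (v := (msqrt S₀ * (U : Matrix (Fin n) (Fin n) ℝ)) *ᵥ x) hb hbs hq ?_ ?_
  · rwa [dotProduct_mulVec_mul_self, msqrt_transpose, msqrt_mul_self hS] at h1
  · rw [← mulVec_mulVec, dotProduct_mulVec_mul_self (msqrt S₀), msqrt_transpose,
      msqrt_mul_self hS₀]
    have h2 := (posSemidef_sub_smul_one_iff_dotProduct hS₀.isHermitian _).1
      (posSemidef_sub_sigmaMin_sq hn hS₀) ((U : Matrix (Fin n) (Fin n) ℝ) *ᵥ x)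
    rwa [dotProduct_mulVec_mul_self, hUU, one_mulVec] at h2
  · rw [← neg_sub (msqrt S *ᵥ x), neg_dotProduct_neg, ← sub_mulVec]
    refine (mulVec_dotProduct_self_le _ _).trans (mul_le_mul_of_nonneg_right ?_ hq)
    rw [← frobNorm_sq]
    exact pow_le_pow_left₀ (Real.sqrt_nonneg _) hU 2

theorem posSemidef_sub_sq_of_margin (hn : 0 < n) (hS₀ : S₀.PosSemidef) (hS : S.PosSemidef)
    {c : ℝ} (hc : 0 < c) (hmargin : HasModifiedDeficiencyMargin S₀ S c) :
    (S - c ^ 2 • 1).PosSemidef := by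
  rw [posSemidef_sub_smul_one_iff_le_lambdaMin hn hS.isHermitian]
  refine le_of_forall_pos_lt_add fun e he => ?_
  -- Keeps `c - e'` nonnegative and makes `2 c e' < e`, so that `c ^ 2 < (c - e') ^ 2 + e`.
  set e' := min c (e / (4 * c))
  have he' : 0 < e' := lt_min hc (by positivity)
  have h1 : e' ≤ c := min_le_left _ _
  have h2 : e' * (4 * c) ≤ e := by
    rw [← le_div_iff₀ (by positivity)]
    exact min_le_right _ _
  obtain ⟨U, hU⟩ := exists_orthogonal_of_margin he' hmargin
  have hcs := le_sigmaMin_of_margin hmargin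
  have h3 := posSemidef_sub_sq_of_frobNorm_le hn hS₀ hS (b := c - e') (by linarith) (by linarith) U
    (by linarith)
  rw [posSemidef_sub_smul_one_iff_le_lambdaMin hn hS.isHermitian] at h3
  nlinarith

/-- The Bures-Wasserstein distance is bounded by every Procrustes residual. -/
theorem bwLoss_le_frobNorm_sq (hS₀ : S₀.PosDef) (hS : S.PosDef)
    (U : Matrix.orthogonalGroup (Fin n) ℝ) :
    bwLoss S₀ S ≤ frobNorm (msqrt S - msqrt S₀ * (U : Matrix (Fin n) (Fin n) ℝ)) ^ 2 := by
  have hUU : (U : Matrix (Fin n) (Fin n) ℝ) * (U : Matrix (Fin n) (Fin n) ℝ)ᵀ = 1 :=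
    (mem_orthogonalGroup_iff _ _).1 U.2
  generalize (U : Matrix (Fin n) (Fin n) ℝ) = V at hUU ⊢
  have hMpd := posDef_msqrt (posDef_conj_msqrt hS₀ hS)
  have hM := msqrt_mul_self (posDef_conj_msqrt hS₀ hS).posSemidef
  have hu := isUnit_det_msqrt_conj hS₀ hS
  have hX := msqrt_mul_self hS.posSemidef
  have hR := msqrt_mul_self hS₀.posSemidef
  have hXt := msqrt_transpose S
  have hRt := msqrt_transpose S₀
  have hMt := msqrt_transpose (msqrt S₀ * S * msqrt S₀)
  rw [frobNorm_sq, bwLoss_eq]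
  set M := msqrt (msqrt S₀ * S * msqrt S₀)
  set R := msqrt S₀
  set X := msqrt S
  have hcyc : (Vᵀ * R * R * V).trace = S₀.trace := by
    rw [Matrix.mul_assoc Vᵀ, hR, trace_mul_comm, ← Matrix.mul_assoc, hUU, Matrix.one_mul]
  have hcross : (Vᵀ * R * X).trace = (X * R * V).trace := by
    rw [← trace_transpose, transpose_mul, transpose_mul, hXt, hRt, transpose_transpose,
      Matrix.mul_assoc]
  have h1 : ((X - R * V)ᵀ * (X - R * V)).trace = S.trace - 2 * (X * R * V).trace + S₀.trace := by
    rw [transpose_sub, transpose_mul, hXt, hRt, Matrix.sub_mul, Matrix.mul_sub, Matrix.mul_sub,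
      hX, trace_sub, trace_sub, trace_sub, hcross, ← Matrix.mul_assoc, ← Matrix.mul_assoc, hcyc]
    ring
  -- Completing the square with weight `M⁻¹` gives `tr (X R V) ≤ tr M`, the variational bound for
  -- the nuclear norm of `X R`.
  have h2 := (posSemidef_transpose_mul_mul hMpd.inv.posSemidef (X * R - Vᵀ * M)ᵀ).trace_nonneg
  have e1 : (Vᵀ * M)ᵀ = M * V := by rw [transpose_mul, transpose_transpose, hMt]
  have e2 : (X * R)ᵀ = R * X := by rw [transpose_mul, hXt, hRt]
  have e3 : M * V * (Vᵀ * M) = M * M := by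
    rw [Matrix.mul_assoc, ← Matrix.mul_assoc V, hUU, Matrix.one_mul]
  have h3 : ((X * R - Vᵀ * M) * M⁻¹ * (X * R - Vᵀ * M)ᵀ).trace
      = 2 * M.trace - 2 * (X * R * V).trace := by
    have i1 : (X * R * M⁻¹ * (R * X)).trace = M.trace := by
      rw [trace_mul_comm, ← Matrix.mul_assoc, Matrix.mul_assoc R X, ← Matrix.mul_assoc X X R, hX,
        ← Matrix.mul_assoc R S R, ← hM, Matrix.mul_assoc, mul_nonsing_inv _ hu, Matrix.mul_one]
    have i2 : X * R * M⁻¹ * (M * V) = X * R * V := by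
      rw [Matrix.mul_assoc (X * R), ← Matrix.mul_assoc M⁻¹, nonsing_inv_mul _ hu, Matrix.one_mul]
    have i3 : Vᵀ * M * M⁻¹ = Vᵀ := by rw [Matrix.mul_assoc, mul_nonsing_inv _ hu, Matrix.mul_one]
    have i4 : (Vᵀ * (M * V)).trace = M.trace := by
      rw [trace_mul_comm, Matrix.mul_assoc, hUU, Matrix.mul_one]
    rw [transpose_sub, e1, e2, Matrix.sub_mul, i3, Matrix.sub_mul, Matrix.mul_sub, Matrix.mul_sub,
      trace_sub, trace_sub, trace_sub, i1, i2, i4, ← Matrix.mul_assoc, hcross]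
    ring
  rw [transpose_transpose, h3] at h2
  rw [h1]
  linarith

theorem bwLoss_le_of_margin (hS₀ : S₀.PosDef) (hS : S.PosDef)
    {c : ℝ} (hmargin : HasModifiedDeficiencyMargin S₀ S c) :
    bwLoss S₀ S ≤ (sigmaMin (msqrt S₀) - c) ^ 2 := by
  rw [← Real.sqrt_le_left (sub_nonneg.2 (le_sigmaMin_of_margin hmargin))]
  refine le_trans (le_ciInf fun U => ?_) hmargin
  exact Real.sqrt_le_iff.2 ⟨Real.sqrt_nonneg _, bwLoss_le_frobNorm_sq hS₀ hS U⟩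

/-- Here `S^{1/2} Γ` plays the role of `S₀^{1/2} U`: its Gram matrix is `S₀`, and its squared
Frobenius distance to `S^{1/2}` is the loss. Only the size of the loss enters, so the bound survives
along a flow that decreases it. -/
theorem posSemidef_sub_sq_of_bwLoss_le (hn : 0 < n) (hS₀ : S₀.PosDef) (hS : S.PosDef)
    {c : ℝ} (hc : 0 ≤ c) (hcs : c ≤ sigmaMin (msqrt S₀))
    (h : bwLoss S₀ S ≤ (sigmaMin (msqrt S₀) - c) ^ 2) : (S - c ^ 2 • 1).PosSemidef := by
  rw [posSemidef_sub_smul_one_iff_dotProduct hS.isHermitian]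
  intro x
  have hX := msqrt_mul_self hS.posSemidef
  have hXt := msqrt_transpose S
  have hq : 0 ≤ x ⬝ᵥ x := by
    have := dotProduct_star_self_nonneg x
    rwa [star_trivial] at this
  have h1 := sq_mul_le_dotProduct_self (u := msqrt S *ᵥ x)
    (v := (msqrt S * transportMap S₀ S) *ᵥ x) hc hcs hq ?_ ?_
  · rwa [dotProduct_mulVec_mul_self, hXt, hX] at h1
  · rw [dotProduct_mulVec_mul_self, transpose_mul, transportMap_transpose, hXt, Matrix.mul_assoc,
      ← Matrix.mul_assoc (msqrt S), hX, ← Matrix.mul_assoc, transportMap_mul_mul hS₀ hS]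
    exact (posSemidef_sub_smul_one_iff_dotProduct hS₀.isHermitian _).1
      (posSemidef_sub_sigmaMin_sq hn hS₀.posSemidef) x
  · rw [← neg_sub (msqrt S *ᵥ x), neg_dotProduct_neg, ← sub_mulVec]
    refine (mulVec_dotProduct_self_le _ _).trans (mul_le_mul_of_nonneg_right ?_ hq)
    refine le_trans (le_of_eq ?_) h
    have : msqrt S - msqrt S * transportMap S₀ S = msqrt S * (1 - transportMap S₀ S) := by
      rw [Matrix.mul_sub, Matrix.mul_one]
    rw [bwLoss_eq_trace hS₀ hS, this, transpose_mul, hXt, transpose_sub, transpose_one,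
      transportMap_transpose, Matrix.mul_assoc, ← Matrix.mul_assoc (msqrt S), hX,
      ← Matrix.mul_assoc]

/-- Taking `U = 1` bounds the loss by the squared distance of the square roots, which the Lipschitz
estimate controls by `‖S - S₀‖² / σ_min²`. The hypothesis trades one factor of the loss for
`σ_min²`. -/
theorem bwLoss_le_frobNorm_sub (hn : 0 < n) (hS₀ : S₀.PosDef) (hS : S.PosDef)
    (h : bwLoss S₀ S ≤ sigmaMin (msqrt S₀) ^ 2) : bwLoss S₀ S ≤ frobNorm (S - S₀) := by
  have h0 := bwLoss_nonneg hS₀ hS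
  have h1 := bwLoss_le_frobNorm_sq hS₀ hS 1
  rw [OneMemClass.coe_one, Matrix.mul_one, frobNorm_sq] at h1
  have h2 := sq_mul_trace_sub_le (sigmaMin_nonneg _) (msqrt_posSemidef S₀) (msqrt_posSemidef S)
    (posSemidef_msqrt_sub_sigmaMin hn hS₀.posSemidef)
  have h3 : ∀ A B : Matrix (Fin n) (Fin n) ℝ, (A - B)ᵀ * (A - B) = (B - A)ᵀ * (B - A) := by
    intro A B
    rw [← neg_sub, transpose_neg, Matrix.neg_mul, Matrix.mul_neg, neg_neg]
  rw [msqrt_mul_self hS₀.posSemidef, msqrt_mul_self hS.posSemidef, h3, h3 S₀,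
    ← frobNorm_sq (S - S₀)] at h2
  refine abs_le_of_sq_le_sq' ?_ (Real.sqrt_nonneg _) |>.2
  calc bwLoss S₀ S ^ 2 ≤ sigmaMin (msqrt S₀) ^ 2 * bwLoss S₀ S := by nlinarith
    _ ≤ _ := (mul_le_mul_of_nonneg_left h1 (sq_nonneg _)).trans h2

end Loss

/-! ### Layer products, balanced weights and the gradient in parameter space. -/

section Network

variable {N : ℕ} {d : ℕ → ℕ}

/-- The partial product `W_N ⋯ W_{k+1}`, for `k ≤ N` (the identity if `k = N`). -/
def suffixProd (W : Params N d) (k : ℕ) (hk : k ≤ N) : Matrix (Fin (d N)) (Fin (d k)) ℝ :=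
  Nat.decreasingInduction (motive := fun k _ => Matrix (Fin (d N)) (Fin (d k)) ℝ)
    (fun k h U => U * layer W k h) 1 hk

theorem suffixProd_self (W : Params N d) : suffixProd W N le_rfl = 1 :=
  Nat.decreasingInduction_self _ _

theorem suffixProd_eq_mul (W : Params N d) (k : ℕ) (hk : k < N) :
    suffixProd W k hk.le = suffixProd W (k + 1) hk * layer W k hk :=
  Nat.decreasingInduction_succ_left _ _ _ _

theorem partialProd_succ (W : Params N d) (k : ℕ) (hk : k < N) :
    partialProd W (k + 1) hk = layer W k hk * partialProd W k hk.le := rfl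

theorem suffixProd_mul_partialProd (W : Params N d) (k : ℕ) (hk : k ≤ N) :
    suffixProd W k hk * partialProd W k hk = endToEnd W := by
  induction hk using Nat.decreasingInduction with
  | self => rw [suffixProd_self, Matrix.one_mul, endToEnd]
  | of_succ k hk ih => rw [suffixProd_eq_mul W k hk, Matrix.mul_assoc, ← partialProd_succ, ih]

/-- Balancedness turns the outer Gram matrix of one layer into the inner one of the next, so the
product collapses to a power. -/
theorem partialProd_mul_transpose {W : Params N d} (hW : Balanced W) (k : ℕ) (hk : k < N) :
    partialProd W k hk.le * (partialProd W k hk.le)ᵀ = ((layer W k hk)ᵀ * layer W k hk) ^ k := by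
  induction k with
  | zero => simp [partialProd]
  | succ k ih =>
    have hk' := Nat.lt_of_succ_lt hk
    have key : ∀ (B : Matrix (Fin (d (k + 1))) (Fin (d k)) ℝ) (j : ℕ),
        B * (Bᵀ * B) ^ j = (B * Bᵀ) ^ j * B := by
      intro B j
      induction j with
      | zero => simp
      | succ j ihj => rw [pow_succ, ← Matrix.mul_assoc, ihj, pow_succ]; simp only [Matrix.mul_assoc]
    rw [partialProd_succ W k hk', transpose_mul, Matrix.mul_assoc,
      ← Matrix.mul_assoc (partialProd W k _), ih hk', ← Matrix.mul_assoc, key, Matrix.mul_assoc,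
      ← pow_succ, hW k hk]

/-- The witness is `P = W_N W_Nᵀ`. Balancedness carries the inner Gram matrix of any layer leftwards
through the later layers until it emerges as `P`. -/
theorem suffixProd_mul_gram {W : Params N d} (hW : Balanced W) (M : ℕ) (hM : M + 1 = N) :
    ∃ P : Matrix (Fin (d N)) (Fin (d N)) ℝ, P.PosSemidef ∧
      (∀ k (hk : k < N), suffixProd W k hk.le * ((layer W k hk)ᵀ * layer W k hk)
        = P * suffixProd W k hk.le) ∧
      ∀ k (hk : k ≤ N), suffixProd W k hk * (suffixProd W k hk)ᵀ = P ^ (N - k) := by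
  subst hM
  refine ⟨layer W M M.lt_succ_self * (layer W M M.lt_succ_self)ᵀ,
    posSemidef_mul_transpose_self _, ?_⟩
  have hlast : suffixProd W M M.le_succ = layer W M M.lt_succ_self := by
    rw [suffixProd_eq_mul W M M.lt_succ_self, suffixProd_self, Matrix.one_mul]
  have h1 : ∀ k (hk : k ≤ M), suffixProd W k (Nat.lt_succ_of_le hk).le
      * ((layer W k (Nat.lt_succ_of_le hk))ᵀ * layer W k (Nat.lt_succ_of_le hk))
      = layer W M M.lt_succ_self * (layer W M M.lt_succ_self)ᵀ
        * suffixProd W k (Nat.lt_succ_of_le hk).le := by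
    intro k hk
    induction hk using Nat.decreasingInduction with
    | self => rw [hlast, Matrix.mul_assoc]
    | of_succ k hk ih =>
      rw [suffixProd_eq_mul W k (hk.trans M.lt_succ_self),
        ← Matrix.mul_assoc (layer W M M.lt_succ_self * (layer W M M.lt_succ_self)ᵀ), ← ih,
        ← hW k (Nat.succ_lt_succ hk)]
      simp only [Matrix.mul_assoc]
  refine ⟨fun k hk => h1 k (Nat.le_of_lt_succ hk), fun k hk => ?_⟩
  induction hk using Nat.decreasingInduction with
  | self => simp [suffixProd_self]
  | of_succ k hk ih =>
    rcases (Nat.le_of_lt_succ hk).eq_or_lt with rfl | hkM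
    · rw [hlast]; simp
    · have h2 : M + 1 - k = M + 1 - (k + 1) + 1 := by omega
      rw [h2, pow_succ', ← ih, ← Matrix.mul_assoc, ← h1 (k + 1) hkM,
        ← hW k (Nat.succ_lt_succ hkM), suffixProd_eq_mul W k hk, transpose_mul]
      simp only [Matrix.mul_assoc]

/-- The component of the gradient of `W ↦ f (W_N ⋯ W_1)` at layer `k`, where `Z` is the gradient
of `f` at `W_N ⋯ W_1`. -/
def layerGrad (W : Params N d) (Z : Matrix (Fin (d N)) (Fin (d 0)) ℝ) (k : ℕ) (hk : k < N) :
    Matrix (Fin (d (k + 1))) (Fin (d k)) ℝ :=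
  (suffixProd W (k + 1) hk)ᵀ * Z * (partialProd W k hk.le)ᵀ

/-- The tuple of matrices `layerGrad`. -/
def paramGrad (W : Params N d) (Z : Matrix (Fin (d N)) (Fin (d 0)) ℝ) : Params N d :=
  WithLp.toLp 2 fun j => WithLp.toLp 2 fun p => layerGrad W Z j.1 j.2 p.1 p.2

theorem layer_paramGrad (W : Params N d) (Z : Matrix (Fin (d N)) (Fin (d 0)) ℝ) (k : ℕ)
    (hk : k < N) : layer (paramGrad W Z) k hk = layerGrad W Z k hk := rfl

theorem inner_eq_sum_trace (V W : Params N d) :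
    inner ℝ V W = ∑ j : Fin N, ((layer V j.1 j.2)ᵀ * layer W j.1 j.2).trace := by
  rw [PiLp.inner_apply]
  refine Finset.sum_congr rfl fun j _ => ?_
  rw [PiLp.inner_apply, Fintype.sum_prod_type, Finset.sum_comm]
  simp [Matrix.trace, Matrix.mul_apply, layer, mul_comm]

/-- Lower bound for the gradient at balanced weights. -/
theorem le_inner_paramGrad {W : Params N d} (hN : N ≠ 0) (hW : Balanced W) {p : ℝ} (hp : 0 ≤ p)
    (hcov : (covariance W - p ^ N • 1).PosSemidef) {G : Matrix (Fin (d N)) (Fin (d N)) ℝ}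
    (hG : Gᵀ = G) :
    N * p ^ (N - 1) * (G * covariance W * G).trace
      ≤ inner ℝ (paramGrad W (G * endToEnd W)) (paramGrad W (G * endToEnd W)) := by
  obtain ⟨P, hP, h1, h2⟩ := suffixProd_mul_gram hW (N - 1)
    (Nat.sub_add_cancel (Nat.pos_of_ne_zero hN))
  have hend : endToEnd W = suffixProd W 0 (Nat.zero_le N) := by
    rw [← suffixProd_mul_partialProd W 0 (Nat.zero_le N), partialProd, Matrix.mul_one]
  have hcovP : covariance W = P ^ N := by rw [covariance, hend, h2, Nat.sub_zero]
  rw [hcovP] at hcov ⊢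
  have hPp := posSemidef_sub_of_pow hP hN hcov
  have hpow : ∀ k (hk : k < N) (j : ℕ),
      suffixProd W k hk.le * ((layer W k hk)ᵀ * layer W k hk) ^ j = P ^ j * suffixProd W k hk.le := by
    intro k hk j
    induction j with
    | zero => simp
    | succ j ih => rw [pow_succ, ← Matrix.mul_assoc, ih, Matrix.mul_assoc, h1, pow_succ,
        Matrix.mul_assoc]
  have hpre : ∀ k (hk : k < N),
      endToEnd W * (partialProd W k hk.le)ᵀ = P ^ k * suffixProd W k hk.le := by
    intro k hk
    rw [← suffixProd_mul_partialProd W k hk.le, Matrix.mul_assoc, partialProd_mul_transpose hW k hk,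
      hpow]
  rw [inner_eq_sum_trace]
  -- With `k` counted from zero, the layer contributes `tr (G P^(N-k-1) G P^(N+k))`. Removing
  -- `N-k-1` and `k` factors leaves the same bound for every layer, whence the factor `N`.
  have hterm : ∀ j : Fin N, p ^ (N - 1) * (G * P ^ N * G).trace
      ≤ ((layer (paramGrad W (G * endToEnd W)) j.1 j.2)ᵀ
        * layer (paramGrad W (G * endToEnd W)) j.1 j.2).trace := by
    rintro ⟨k, hk⟩
    have hPt : (P ^ k)ᵀ = P ^ k := transpose_eq_of_posSemidef (hP.pow k)
    have e1 := trace_mul_pow_mul_ge hP hG hp hPp (N - (k + 1)) k N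
    have e2 : N - (k + 1) + k = N - 1 := by omega
    rw [e2] at e1
    refine e1.trans (le_of_eq ?_)
    have e3 : layerGrad W (G * endToEnd W) k hk
        = (suffixProd W (k + 1) hk)ᵀ * (G * (P ^ k * suffixProd W k hk.le)) := by
      rw [layerGrad, ← hpre k hk]
      simp only [Matrix.mul_assoc]
    have e4 : N + k = k + (N - k) + k := by omega
    rw [layer_paramGrad, e3, ← h2 (k + 1) hk, e4, pow_add, pow_add, ← h2 k hk.le]
    generalize suffixProd W (k + 1) hk = U
    generalize suffixProd W k hk.le = V
    generalize P ^ k = Q at hPt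
    simp only [transpose_mul, transpose_transpose, hPt, hG]
    calc (G * (U * Uᵀ) * G * (Q * (V * Vᵀ) * Q)).trace
        = ((G * U * Uᵀ * G * Q * V * Vᵀ) * Q).trace := by simp only [Matrix.mul_assoc]
      _ = ((Q * G * U * Uᵀ * G * Q * V) * Vᵀ).trace := by
        rw [trace_mul_comm]; simp only [Matrix.mul_assoc]
      _ = _ := by rw [trace_mul_comm]; simp only [Matrix.mul_assoc]
  calc _ = ∑ _j : Fin N, p ^ (N - 1) * (G * P ^ N * G).trace := by
        rw [Finset.sum_const, Finset.card_univ, Fintype.card_fin, nsmul_eq_mul, mul_assoc]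
    _ ≤ _ := Finset.sum_le_sum fun j _ => hterm j

/-- The derivative of `partialProd` at `W` in direction `V`. -/
def partialProdDeriv (W V : Params N d) : (k : ℕ) → k ≤ N → Matrix (Fin (d k)) (Fin (d 0)) ℝ
  | 0, _ => 0
  | k + 1, h => layer V k h * partialProd W k (Nat.le_of_succ_le h)
      + layer W k h * partialProdDeriv W V k (Nat.le_of_succ_le h)

/-- The layer gradients form the adjoint of the derivative of the product map. Completing each
partial product by its suffix makes the product rule add one layer per induction step. -/
theorem trace_mul_partialProdDeriv (W V : Params N d) (Z : Matrix (Fin (d N)) (Fin (d 0)) ℝ) :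
    (Zᵀ * partialProdDeriv W V N le_rfl).trace = inner ℝ (paramGrad W Z) V := by
  have key : ∀ k (hk : k ≤ N),
      (Zᵀ * (suffixProd W k hk * partialProdDeriv W V k hk)).trace
        = ∑ j : Fin k, ((layerGrad W Z j.1 (j.2.trans_le hk))ᵀ
            * layer V j.1 (j.2.trans_le hk)).trace := by
    intro k
    induction k with
    | zero => intro hk; simp [partialProdDeriv]
    | succ k ih =>
      intro hk
      rw [Fin.sum_univ_castSucc]
      simp only [Fin.val_castSucc, Fin.val_last]
      rw [← ih (Nat.le_of_succ_le hk), partialProdDeriv, Matrix.mul_add, Matrix.mul_add, trace_add,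
        add_comm, suffixProd_eq_mul W k hk, ← Matrix.mul_assoc (suffixProd W (k + 1) hk)
        (layer W k hk)]
      congr 1
      rw [layerGrad]
      simp only [transpose_mul, transpose_transpose, ← Matrix.mul_assoc]
      rw [trace_mul_comm]
      simp only [← Matrix.mul_assoc]
  rw [inner_eq_sum_trace]
  have := key N le_rfl
  rw [suffixProd_self, Matrix.one_mul] at this
  exact this

theorem hasDerivWithinAt_mul_apply {l m n : ℕ} {F : ℝ → Matrix (Fin l) (Fin m) ℝ}
    {H : ℝ → Matrix (Fin m) (Fin n) ℝ} {F' : Matrix (Fin l) (Fin m) ℝ}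
    {H' : Matrix (Fin m) (Fin n) ℝ} {s : Set ℝ} {t : ℝ}
    (hF : ∀ a b, HasDerivWithinAt (fun τ => F τ a b) (F' a b) s t)
    (hH : ∀ a b, HasDerivWithinAt (fun τ => H τ a b) (H' a b) s t) (a : Fin l) (b : Fin n) :
    HasDerivWithinAt (fun τ => (F τ * H τ) a b) ((F' * H t + F t * H') a b) s t := by
  simp only [Matrix.mul_apply, Matrix.add_apply, ← Finset.sum_add_distrib]
  exact HasDerivWithinAt.fun_sum fun i _ => (hF a i).mul (hH i b)

theorem hasDerivWithinAt_layer {γ : ℝ → Params N d} {V : Params N d} {s : Set ℝ} {t : ℝ}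
    (hγ : HasDerivWithinAt γ V s t) (k : ℕ) (hk : k < N) (a : Fin (d (k + 1))) (b : Fin (d k)) :
    HasDerivWithinAt (fun τ => layer (γ τ) k hk a b) (layer V k hk a b) s t :=
  ((EuclideanSpace.proj (𝕜 := ℝ) (a, b)).comp (PiLp.proj 2
    (fun j : Fin N => EuclideanSpace ℝ (Fin (d (j.1 + 1)) × Fin (d j.1)))
    (⟨k, hk⟩ : Fin N))).hasFDerivAt.comp_hasDerivWithinAt t hγ

theorem hasDerivWithinAt_partialProd {γ : ℝ → Params N d} {V : Params N d} {s : Set ℝ} {t : ℝ}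
    (hγ : HasDerivWithinAt γ V s t) (k : ℕ) (hk : k ≤ N) :
    ∀ (a : Fin (d k)) (b : Fin (d 0)), HasDerivWithinAt (fun τ => partialProd (γ τ) k hk a b)
      (partialProdDeriv (γ t) V k hk a b) s t := by
  induction k with
  | zero => exact fun a b => hasDerivWithinAt_const _ _ _
  | succ k ih =>
    exact hasDerivWithinAt_mul_apply (hasDerivWithinAt_layer hγ k hk)
      (ih (Nat.le_of_succ_le hk))

theorem differentiable_partialProd (k : ℕ) (hk : k ≤ N) (a : Fin (d k)) (b : Fin (d 0)) :
    Differentiable ℝ fun W : Params N d => partialProd W k hk a b := by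
  induction k with
  | zero => exact differentiable_const _
  | succ k ih =>
    simp only [partialProd, Matrix.mul_apply]
    refine Differentiable.fun_sum fun i _ => Differentiable.mul ?_ (ih _ _)
    simp only [layer, Matrix.of_apply]
    fun_prop

theorem differentiable_covariance (a b : Fin (d N)) :
    Differentiable ℝ fun W : Params N d => covariance W a b := by
  simp only [covariance, endToEnd, Matrix.mul_apply, transpose_apply]
  exact Differentiable.fun_sum fun i _ =>
    (differentiable_partialProd _ _ _ _).mul (differentiable_partialProd _ _ _ _)

theorem covariance_posSemidef (W : Params N d) : (covariance W).PosSemidef :=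
  posSemidef_mul_transpose_self _

/-- The gradient of the loss in parameter space. -/
theorem hasGradientAt_paramLoss (hn : 0 < d N) {S₀ : Matrix (Fin (d N)) (Fin (d N)) ℝ}
    (hS₀ : S₀.PosDef) {W : Params N d} (hW : (covariance W).PosDef) :
    HasGradientAt (paramLoss S₀)
      (paramGrad W (((2 : ℝ) • (1 - transportMap S₀ (covariance W))) * endToEnd W)) W := by
  obtain ⟨K, hK⟩ := exists_abs_bwLoss_sub_le hn hS₀ hW
  set G := 1 - transportMap S₀ (covariance W) with hG
  have hGt : Gᵀ = G := by rw [hG, transpose_sub, transpose_one, transportMap_transpose]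
  set q : Params N d → ℝ := fun V => (G * (covariance V - covariance W)).trace with hq
  have hqdiff : Differentiable ℝ q := by
    simp only [hq, Matrix.trace, Matrix.diag_apply, Matrix.mul_apply, Matrix.sub_apply]
    refine Differentiable.fun_sum fun i _ => Differentiable.fun_sum fun j _ => ?_
    exact ((differentiable_covariance j i).sub_const _).const_mul _
  have hqgrad : HasFDerivAt q (InnerProductSpace.toDual ℝ _
      (paramGrad W (((2 : ℝ) • G) * endToEnd W))) W := by
    -- Differentiability being known, the derivative is identified along the lines `W + s V`.
    refine (hqdiff W).hasFDerivAt.congr_fderiv ?_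
    ext V
    rw [InnerProductSpace.toDual_apply_apply, ← trace_mul_partialProdDeriv]
    set γ : ℝ → Params N d := fun s => W + s • V with hγ
    have hγ0 : γ 0 = W := by simp [hγ]
    have hγd : HasDerivAt γ V 0 := by
      simpa [hγ] using ((hasDerivAt_id (0 : ℝ)).smul_const V).const_add W
    have hfd : HasFDerivAt q (fderiv ℝ q W) (γ 0) := hγ0 ▸ (hqdiff W).hasFDerivAt
    have c1 := hfd.comp_hasDerivAt (0 : ℝ) hγd
    have hE := hasDerivWithinAt_partialProd (hasDerivWithinAt_univ.2 hγd) N le_rfl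
    have hC := hasDerivWithinAt_mul_apply hE (H := fun τ => (partialProd (γ τ) N le_rfl)ᵀ)
      (H' := (partialProdDeriv (γ 0) V N le_rfl)ᵀ) (fun a b => hE b a)
    have c2 : HasDerivAt (q ∘ γ) (G * (partialProdDeriv (γ 0) V N le_rfl
        * (partialProd (γ 0) N le_rfl)ᵀ
        + partialProd (γ 0) N le_rfl * (partialProdDeriv (γ 0) V N le_rfl)ᵀ)).trace 0 := by
      have : q ∘ γ = fun τ => ∑ i, ∑ j, G i j * (covariance (γ τ) j i - covariance W j i) := by
        ext τ
        simp [hq, Matrix.trace, Matrix.mul_apply]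
      rw [this]
      simp only [Matrix.trace, Matrix.diag_apply, Matrix.mul_apply (M := G)]
      refine HasDerivAt.fun_sum fun i _ => HasDerivAt.fun_sum fun j _ => ?_
      exact ((hasDerivWithinAt_univ.1 (hC j i)).sub_const _).const_mul _
    rw [c1.unique c2, hγ0]
    have hend : partialProd W N le_rfl = endToEnd W := rfl
    rw [hend]
    generalize partialProdDeriv W V N le_rfl = D
    generalize endToEnd W = E
    rw [Matrix.mul_add, trace_add, transpose_mul, transpose_smul, hGt, Matrix.mul_smul,
      Matrix.smul_mul, trace_smul, smul_eq_mul, two_mul]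
    congr 1
    · rw [← Matrix.mul_assoc, trace_mul_comm, Matrix.mul_assoc]
    · rw [← trace_transpose]
      simp only [transpose_mul, transpose_transpose, hGt]
      rw [Matrix.mul_assoc, trace_mul_comm]
  set r : Params N d → ℝ := fun V =>
    ∑ i, ∑ j, (msqrt S₀ * (covariance V - covariance W) * msqrt S₀) i j ^ 2 with hr
  have hrdiff : Differentiable ℝ r := by
    simp only [hr, Matrix.mul_apply, Matrix.sub_apply]
    refine Differentiable.fun_sum fun i _ => Differentiable.fun_sum fun j _ =>
      Differentiable.fun_pow (Differentiable.fun_sum fun k _ => Differentiable.mul_const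
        (Differentiable.fun_sum fun l _ => ?_) _) 2
    exact ((differentiable_covariance l k).sub_const _).const_mul _
  have hrW : r W = 0 := by simp [hr]
  -- The polynomial error bound is nonnegative and vanishes at `W`, so its derivative there is zero;
  -- this yields the little-o estimate for the loss.
  have hrgrad : HasFDerivAt r (0 : Params N d →L[ℝ] ℝ) W := by
    refine (hrdiff W).hasFDerivAt.congr_fderiv ?_
    refine IsLocalMin.fderiv_eq_zero (Filter.Eventually.of_forall fun V => ?_)
    rw [hrW]
    exact Finset.sum_nonneg fun i _ => Finset.sum_nonneg fun j _ => sq_nonneg _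
  have hdefect : HasFDerivAt (fun V => paramLoss S₀ V - q V) (0 : Params N d →L[ℝ] ℝ) W := by
    rw [hasFDerivAt_iff_isLittleO]
    rw [hasFDerivAt_iff_isLittleO] at hrgrad
    refine Asymptotics.IsBigO.trans_isLittleO (Asymptotics.IsBigO.of_bound |K| ?_) hrgrad
    refine Filter.Eventually.of_forall fun V => ?_
    have hV := hK (covariance V) (covariance_posSemidef V)
    have hqW : q W = 0 := by simp [hq]
    have hr0 : 0 ≤ r V :=
      Finset.sum_nonneg fun i _ => Finset.sum_nonneg fun j _ => sq_nonneg _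
    simp only [_root_.zero_apply, sub_zero, hqW, hrW, Real.norm_eq_abs]
    have e : paramLoss S₀ V - q V - paramLoss S₀ W
        = bwLoss S₀ (covariance V) - bwLoss S₀ (covariance W)
          - (G * (covariance V - covariance W)).trace := by
      simp only [paramLoss, hq]; ring
    rw [e, abs_of_nonneg hr0]
    exact hV.trans (mul_le_mul_of_nonneg_right (le_abs_self K) hr0)
  have := hdefect.fun_add hqgrad
  simp only [sub_add_cancel, zero_add] at this
  rwa [hasGradientAt_iff_hasFDerivAt]

end Network

/-! ### The gradient flow: lower bound, conservation law and rate. -/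

section Flow

open Set Filter Topology

variable {N : ℕ} {d : ℕ → ℕ} {S₀ : Matrix (Fin (d N)) (Fin (d N)) ℝ} {T : ℝ}
  {W : ℝ → Params N d}

/-- Grönwall's inequality by the integrating factor `exp (r u)`. -/
theorem le_exp_mul_of_hasDerivWithinAt {f f' : ℝ → ℝ} {s r : ℝ}
    (hf : ∀ u ∈ Icc 0 s, HasDerivWithinAt f (f' u) (Icc 0 s) u)
    (hf' : ∀ u ∈ Icc 0 s, f' u ≤ -r * f u) {t : ℝ} (ht : t ∈ Icc 0 s) :
    f t ≤ Real.exp (-r * t) * f 0 := by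
  have hd : ∀ u ∈ Icc 0 s, HasDerivWithinAt (fun u => Real.exp (r * u) * f u)
      (Real.exp (r * u) * r * f u + Real.exp (r * u) * f' u) (Icc 0 s) u := fun u hu => by
    have h1 : HasDerivAt (fun u => Real.exp (r * u)) (Real.exp (r * u) * r) u := by
      simpa using ((hasDerivAt_id u).const_mul r).exp
    exact h1.hasDerivWithinAt.mul (hf u hu)
  have hanti : AntitoneOn (fun u => Real.exp (r * u) * f u) (Icc 0 s) := by
    refine antitoneOn_of_hasDerivWithinAt_nonpos (convex_Icc 0 s)
      (fun u hu => (hd u hu).continuousWithinAt)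
      (fun u hu => (hd u (interior_subset hu)).mono interior_subset) fun u hu => ?_
    have h2 := hf' u (interior_subset hu)
    have h3 := Real.exp_pos (r * u)
    nlinarith
  have h0 := hanti (left_mem_Icc.2 (ht.1.trans ht.2)) ht ht.1
  simp only [mul_zero, Real.exp_zero, one_mul] at h0
  have h1 : Real.exp (-r * t) * Real.exp (r * t) = 1 := by
    rw [← Real.exp_add]; simp
  calc f t = Real.exp (-r * t) * (Real.exp (r * t) * f t) := by rw [← mul_assoc, h1, one_mul]
    _ ≤ _ := mul_le_mul_of_nonneg_left h0 (Real.exp_pos _).le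

theorem continuous_covariance : Continuous (covariance : Params N d → _) :=
  continuous_matrix fun a b => (differentiable_covariance a b).continuous

theorem continuousOn_of_isGradientFlow (hflow : IsGradientFlow S₀ T W) :
    ContinuousOn W (Icc 0 T) := fun t ht => (hflow t ht).continuousWithinAt

/-- The gradient flow equation at a point of differentiability. -/
theorem hasDerivWithinAt_flow (hn : 0 < d N) (hS₀ : S₀.PosDef) (hflow : IsGradientFlow S₀ T W)
    {t : ℝ} (ht : t ∈ Icc 0 T) (hpd : (covariance (W t)).PosDef) :
    HasDerivWithinAt W (-paramGrad (W t)
      (((2 : ℝ) • (1 - transportMap S₀ (covariance (W t)))) * endToEnd (W t))) (Icc 0 T) t := by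
  have := hflow t ht
  rwa [(hasGradientAt_paramLoss hn hS₀ hpd).gradient] at this

theorem hasDerivWithinAt_paramLoss_flow (hn : 0 < d N) (hS₀ : S₀.PosDef)
    (hflow : IsGradientFlow S₀ T W) {t : ℝ} (ht : t ∈ Icc 0 T) (hpd : (covariance (W t)).PosDef) :
    HasDerivWithinAt (fun τ => paramLoss S₀ (W τ))
      (-inner ℝ
        (paramGrad (W t)
          (((2 : ℝ) • (1 - transportMap S₀ (covariance (W t)))) * endToEnd (W t)))
        (paramGrad (W t)
          (((2 : ℝ) • (1 - transportMap S₀ (covariance (W t)))) * endToEnd (W t))))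
      (Icc 0 T) t := by
  have h1 := (hasGradientAt_paramLoss hn hS₀ hpd).hasFDerivAt.comp_hasDerivWithinAt t
    (hasDerivWithinAt_flow hn hS₀ hflow ht hpd)
  rwa [InnerProductSpace.toDual_apply_apply, inner_neg_right] at h1

/-- The deficiency margin bounds the covariance from below along the whole flow. -/
theorem posSemidef_covariance_sub_of_flow (hn : 0 < d N) (hS₀ : S₀.PosDef)
    (hflow : IsGradientFlow S₀ T W) {c : ℝ} (hc : 0 < c) (hcs : c ≤ sigmaMin (msqrt S₀))
    (h0 : (covariance (W 0) - c ^ 2 • 1).PosSemidef)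
    (hloss : paramLoss S₀ (W 0) ≤ (sigmaMin (msqrt S₀) - c) ^ 2) :
    ∀ t ∈ Icc 0 T, (covariance (W t) - c ^ 2 • 1).PosSemidef := by
  have hpd : ∀ t, (covariance (W t) - c ^ 2 • 1).PosSemidef → (covariance (W t)).PosDef :=
    fun t => posDef_of_posSemidef_sub_smul_one (by positivity)
  have hcont := continuousOn_of_isGradientFlow hflow
  -- Continuous induction: the bound is a closed condition, and it remains to extend it a little
  -- beyond each `t`.
  refine IsClosed.Icc_subset_of_forall_mem_nhdsGT_of_Icc_subset
    (s := {t | (covariance (W t) - c ^ 2 • 1).PosSemidef}) ?_ h0 ?_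
  · have hcl : IsClosed {V : Params N d | (covariance V - c ^ 2 • 1).PosSemidef} := by
      simp only [posSemidef_sub_smul_one_iff_dotProduct (covariance_posSemidef _).isHermitian,
        ofPred_forall]
      refine isClosed_iInter fun x => isClosed_le continuous_const ?_
      exact continuous_const.dotProduct (continuous_covariance.matrix_mulVec continuous_const)
    have := hcont.preimage_isClosed_of_isClosed isClosed_Icc hcl
    rwa [inter_comm] at this
  · intro t ht hsub
    have htA := hsub (right_mem_Icc.2 ht.1)
    have hdet : ContinuousWithinAt (fun u => (covariance (W u)).det) (Icc 0 T) t :=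
      (continuous_covariance.matrix_det.comp_continuousOn hcont) t (Ico_subset_Icc_self ht)
    -- Invertibility, unlike the bound itself, is an open condition. It keeps the loss
    -- differentiable just beyond `t`, so the loss stays below its initial value there, and that
    -- restores the bound with the same `c`.
    have hev : ∀ᶠ u in 𝓝[Icc 0 T] t, (covariance (W u)).det ≠ 0 :=
      hdet.eventually_ne (hpd t htA).det_pos.ne'
    have hev' : ∀ᶠ u in 𝓝[>] t, u ∈ Icc 0 T ∧ (covariance (W u)).det ≠ 0 := by
      have hle : 𝓝[>] t ≤ 𝓝[Icc 0 T] t := by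
        refine nhdsWithin_le_of_mem ?_
        filter_upwards [Ioo_mem_nhdsGT ht.2] with u hu
        exact ⟨ht.1.trans hu.1.le, hu.2.le⟩
      exact hle (eventually_mem_nhdsWithin.and hev)
    obtain ⟨v, hv, hvsub⟩ := mem_nhdsGT_iff_exists_Ioo_subset.1 hev'
    filter_upwards [Ioo_mem_nhdsGT hv] with u hu
    have hu0 : 0 ≤ u := ht.1.trans hu.1.le
    have huT : u ≤ T := (hvsub hu).1.2
    have hpdu : ∀ w ∈ Icc 0 u, (covariance (W w)).PosDef := by
      intro w hw
      rcases le_or_gt w t with hwt | hwt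
      · exact hpd w (hsub ⟨hw.1, hwt⟩)
      · rw [(covariance_posSemidef (W w)).posDef_iff_det_ne_zero]
        exact (hvsub ⟨hwt, hw.2.trans_lt hu.2⟩).2
    have hmono : Icc 0 u ⊆ Icc 0 T := Icc_subset_Icc_right huT
    have hle := le_exp_mul_of_hasDerivWithinAt (r := 0)
      (fun w hw => (hasDerivWithinAt_paramLoss_flow hn hS₀ hflow (hmono hw) (hpdu w hw)).mono hmono)
      (fun w _ => by
        rw [neg_zero, zero_mul, neg_nonpos]
        exact real_inner_self_nonneg) (right_mem_Icc.2 hu0)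
    rw [neg_zero, zero_mul, Real.exp_zero, one_mul] at hle
    exact posSemidef_sub_sq_of_bwLoss_le hn hS₀ (hpdu u (right_mem_Icc.2 hu0)) hc.le hcs
      (hle.trans hloss)

/-- Balancedness is preserved by the gradient flow. -/
theorem balanced_of_flow (hn : 0 < d N) (hS₀ : S₀.PosDef) (hflow : IsGradientFlow S₀ T W)
    (hpd : ∀ t ∈ Icc 0 T, (covariance (W t)).PosDef) (hbal : Balanced (W 0)) :
    ∀ t ∈ Icc 0 T, Balanced (W t) := by
  intro t ht j hj
  have hj' := Nat.lt_of_succ_lt hj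
  rcases ht.1.eq_or_lt with rfl | ht0
  · exact hbal j hj
  have hT : 0 < T := ht0.trans_le ht.2
  rw [← sub_eq_zero]
  have h0 := sub_eq_zero.2 (hbal j hj)
  ext a b
  have hd : ∀ u ∈ Icc 0 T, HasDerivWithinAt (fun τ =>
      (layer (W τ) j hj' * (layer (W τ) j hj')ᵀ
        - (layer (W τ) (j + 1) hj)ᵀ * layer (W τ) (j + 1) hj) a b) 0 (Icc 0 T) u := by
    intro u hu
    have hW := hasDerivWithinAt_flow hn hS₀ hflow hu (hpd u hu)
    set Z := ((2 : ℝ) • (1 - transportMap S₀ (covariance (W u)))) * endToEnd (W u)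
    have h1 := hasDerivWithinAt_layer hW j hj'
    have h2 := hasDerivWithinAt_layer hW (j + 1) hj
    have h3 := hasDerivWithinAt_mul_apply h1 (H := fun τ => (layer (W τ) j hj')ᵀ)
      (H' := (layer (-paramGrad (W u) Z) j hj')ᵀ) (fun a b => h1 b a) a b
    have h4 := hasDerivWithinAt_mul_apply (F := fun τ => (layer (W τ) (j + 1) hj)ᵀ)
      (F' := (layer (-paramGrad (W u) Z) (j + 1) hj)ᵀ) (fun a b => h2 b a) h2 a b
    refine (h3.sub h4).congr_deriv ?_
    have e1 : layer (-paramGrad (W u) Z) j hj' = -layerGrad (W u) Z j hj' := rfl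
    have e2 : layer (-paramGrad (W u) Z) (j + 1) hj = -layerGrad (W u) Z (j + 1) hj := rfl
    -- Both sides are the same product, bracketed at adjacent layers; hence the two Gram matrices
    -- have equal derivatives.
    have e3 : layerGrad (W u) Z j hj' * (layer (W u) j hj')ᵀ
        = (layer (W u) (j + 1) hj)ᵀ * layerGrad (W u) Z (j + 1) hj := by
      rw [layerGrad, layerGrad, suffixProd_eq_mul (W u) (j + 1) hj,
        partialProd_succ (W u) j hj', transpose_mul, transpose_mul]
      simp only [Matrix.mul_assoc]
    have e4 := congrArg transpose e3
    rw [transpose_mul, transpose_mul, transpose_transpose, transpose_transpose] at e4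
    rw [e1, e2, transpose_neg, transpose_neg, Matrix.neg_mul, Matrix.mul_neg,
      Matrix.neg_mul, Matrix.mul_neg, e3, e4]
    simp only [Matrix.add_apply, Matrix.neg_apply]
    ring
  have hconst := constant_of_derivWithin_zero (fun u hu => (hd u hu).differentiableWithinAt)
    (fun u hu => (hd u (Ico_subset_Icc_self hu)).derivWithin
      (uniqueDiffOn_Icc hT u (Ico_subset_Icc_self hu))) t ht
  rw [hconst, h0]

/-- The exponent splits as `2 (N - 1) / N + 2`, and the spare `c ^ 2` is absorbed by `2 c² K ≤ 1`,
which follows from `c ≤ σ` and `σ² ≤ tr A ≤ C`, with `σ` the least singular value of `A^{1/2}`. -/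
theorem rate_le {n : ℕ} (hn : 0 < n) (hN : 1 ≤ N) {A S : Matrix (Fin n) (Fin n) ℝ}
    (hA : A.PosDef) (hS : S.PosDef) {c : ℝ} (hc : 0 < c) (hcs : c ≤ sigmaMin (msqrt A)) :
    8 * N * c ^ ((2 * (2 * (N : ℝ) - 1)) / N) * constK A S c
      ≤ 4 * (N * (c ^ ((2 : ℝ) / N)) ^ (N - 1)) := by
  have hN0 : (N : ℝ) ≠ 0 := by positivity
  have hpow : c ^ ((2 * (2 * (N : ℝ) - 1)) / N) = (c ^ ((2 : ℝ) / N)) ^ (N - 1) * c ^ 2 := by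
    rw [← Real.rpow_natCast, ← Real.rpow_mul hc.le, ← Real.rpow_natCast c 2, ← Real.rpow_add hc,
      Nat.cast_sub hN]
    congr 1
    push_cast
    field_simp
    ring
  set s := sigmaMin (msqrt A) with hs
  have hs0 : 0 < s := hc.trans_le hcs
  have hlam : lambdaMin A = s ^ 2 := (sigmaMin_msqrt_sq hn hA.posSemidef).symm
  have htr : s ^ 2 ≤ A.trace := by
    have h1 := (posSemidef_sub_sigmaMin_sq hn hA.posSemidef).trace_nonneg
    rw [trace_sub, trace_smul, trace_one, Fintype.card_fin, smul_eq_mul, ← hs, sub_nonneg] at h1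
    have h2 : (1 : ℝ) ≤ n := by exact_mod_cast hn
    nlinarith [sq_nonneg s]
  have hC : s ^ 2 ≤ constC A S := by
    have := bwLoss_nonneg hA hS
    rw [constC]
    nlinarith [sq_nonneg s]
  have hK : 2 * (c ^ 2 * constK A S c) ≤ 1 := by
    have hsq : Real.sqrt (c ^ 2 * s ^ 2) = c * s := by
      rw [← mul_pow, Real.sqrt_sq (by positivity)]
    rw [constK, hlam, hsq]
    have hC0 : 0 < constC A S := (by positivity : 0 < s ^ 2).trans_le hC
    have h1 : c ^ 2 * (c * s) ≤ constC A S ^ 2 :=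
      calc c ^ 2 * (c * s) ≤ s ^ 2 * (s * s) := by gcongr
        _ = (s ^ 2) ^ 2 := by ring
        _ ≤ _ := by gcongr
    have h2 : 2 * (c ^ 2 * (c * s / (2 * constC A S ^ 2))) = c ^ 2 * (c * s) / constC A S ^ 2 := by
      field_simp
    rw [h2]
    exact div_le_one_of_le₀ h1 (by positivity)
  rw [hpow]
  have hq : 0 ≤ (c ^ ((2 : ℝ) / N)) ^ (N - 1) := by positivity
  calc _ = 4 * (N * (c ^ ((2 : ℝ) / N)) ^ (N - 1)) * (2 * (c ^ 2 * constK A S c)) := by ring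
    _ ≤ _ := mul_le_of_le_one_right (by positivity) hK

end Flow

end BWFlow

end

theorem mainTheorem6 (N : ℕ) (hN : 1 ≤ N) (d : ℕ → ℕ) (hd : 1 ≤ d N)
    (S₀ : Matrix (Fin (d N)) (Fin (d N)) ℝ) (hS₀ : S₀.PosSemidef)
    (c : ℝ) (hc : 0 < c) (T : ℝ) (W : ℝ → BWFlow.Params N d)
    (hflow : BWFlow.IsGradientFlow S₀ T W)
    (hbal : BWFlow.Balanced (W 0))
    (hmargin : BWFlow.HasModifiedDeficiencyMargin S₀ (BWFlow.covariance (W 0)) c)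
    (Sstar : Matrix (Fin (d N)) (Fin (d N)) ℝ) (hSstar : Sstar.PosDef)
    (hmin : IsMinOn (BWFlow.bwLoss S₀) {S | S.PosDef} Sstar) :
    ∀ t ∈ Set.Icc (0 : ℝ) T,
      DifferentiableAt ℝ (BWFlow.paramLoss S₀) (W t) ∧
      c ^ 2 ≤ BWFlow.lambdaMin (BWFlow.covariance (W t)) ∧
      BWFlow.bwLoss S₀ (BWFlow.covariance (W t)) - BWFlow.bwLoss S₀ Sstar
        ≤ Real.exp (-8 * N * c ^ ((2 * (2 * (N : ℝ) - 1)) / N)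
              * BWFlow.constK S₀ (BWFlow.covariance (W 0)) c * t)
            * (BWFlow.bwLoss S₀ (BWFlow.covariance (W 0)) - BWFlow.bwLoss S₀ Sstar) ∧
      BWFlow.bwLoss S₀ (BWFlow.covariance (W t)) - BWFlow.bwLoss S₀ Sstar
        ≤ Real.exp (-8 * N * c ^ ((2 * (2 * (N : ℝ) - 1)) / N)
              * BWFlow.constK S₀ (BWFlow.covariance (W 0)) c * t)
            * BWFlow.frobNorm (BWFlow.covariance (W 0) - Sstar) := by
  open BWFlow in
  intro t ht
  have hcs := le_sigmaMin_of_margin hmargin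
  have hs0 : 0 < sigmaMin (msqrt S₀) := hc.trans_le hcs
  -- A positive margin is at most `σ_min (S₀^{1/2})`, so the target is nondegenerate.
  have hS₀pd : S₀.PosDef := posDef_of_posSemidef_sub_smul_one (pow_pos hs0 2)
    (posSemidef_sub_sigmaMin_sq hd hS₀)
  obtain rfl := eq_target_of_isMinOn hS₀pd hSstar hmin
  have hcov0 := posSemidef_sub_sq_of_margin hd hS₀ (covariance_posSemidef (W 0)) hc hmargin
  have hpd0 := posDef_of_posSemidef_sub_smul_one (pow_pos hc 2) hcov0
  have hloss0 := bwLoss_le_of_margin hS₀pd hpd0 hmargin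
  have hcov := posSemidef_covariance_sub_of_flow hd hS₀pd hflow hc hcs hcov0 hloss0
  have hpd : ∀ u ∈ Set.Icc 0 T, (covariance (W u)).PosDef := fun u hu =>
    posDef_of_posSemidef_sub_smul_one (pow_pos hc 2) (hcov u hu)
  have hbalt := balanced_of_flow hd hS₀pd hflow hpd hbal
  set r := 8 * N * c ^ ((2 * (2 * (N : ℝ) - 1)) / N) * constK Sstar (covariance (W 0)) c with hr
  have hrate : r ≤ 4 * (N * (c ^ ((2 : ℝ) / N)) ^ (N - 1)) := rate_le hd hN hS₀pd hpd0 hc hcs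
  have hpN : (c ^ ((2 : ℝ) / N)) ^ N = c ^ 2 := by
    rw [← Real.rpow_natCast, ← Real.rpow_mul hc.le, div_mul_cancel₀ _ (by positivity)]
    exact Real.rpow_natCast c 2
  have hdecay : paramLoss Sstar (W t) ≤ Real.exp (-r * t) * paramLoss Sstar (W 0) := by
    refine le_exp_mul_of_hasDerivWithinAt (f := fun τ => paramLoss Sstar (W τ))
      (fun u hu => hasDerivWithinAt_paramLoss_flow hd hS₀pd hflow hu (hpd u hu)) (fun u hu => ?_) ht
    have hL := bwLoss_eq_trace hS₀pd (hpd u hu)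
    have hL0 := bwLoss_nonneg hS₀pd (hpd u hu)
    set G := 1 - transportMap Sstar (covariance (W u)) with hG
    have hGt : ((2 : ℝ) • G)ᵀ = (2 : ℝ) • G := by
      rw [transpose_smul, hG, transpose_sub, transpose_one, transportMap_transpose]
    -- Applied to `2 G`, whose square supplies the factor 4, with `p` the `N`-th root of `c ^ 2`.
    have h1 := le_inner_paramGrad (Nat.one_le_iff_ne_zero.1 hN) (hbalt u hu)
      (p := c ^ ((2 : ℝ) / N)) (by positivity) (hpN ▸ hcov u hu) hGt
    rw [Matrix.smul_mul, Matrix.smul_mul, Matrix.mul_smul, smul_smul, trace_smul, ← hL,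
      smul_eq_mul] at h1
    have h2 := mul_le_mul_of_nonneg_right hrate hL0
    rw [paramLoss]
    linarith
  have hexp : -8 * N * c ^ ((2 * (2 * (N : ℝ) - 1)) / N) * constK Sstar (covariance (W 0)) c * t
      = -r * t := by rw [hr]; ring
  rw [hexp, bwLoss_target hS₀pd, sub_zero, sub_zero]
  refine ⟨(hasGradientAt_paramLoss hd hS₀pd (hpd t ht)).differentiableAt,
    (posSemidef_sub_smul_one_iff_le_lambdaMin hd (hpd t ht).isHermitian _).1 (hcov t ht), hdecay,
    hdecay.trans (mul_le_mul_of_nonneg_left ?_ (Real.exp_pos _).le)⟩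
  exact bwLoss_le_frobNorm_sub hd hS₀pd hpd0
    (hloss0.trans (pow_le_pow_left₀ (sub_nonneg.2 hcs) (by linarith) 2))
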